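/- Consider the planar system $$\dot x = y,\qquad \dot y = f(x)+y\,g(x)+y^2H(x,y),$$ where $f,g,H$ are of class $C^\infty$ near the origin, $f(x)=ax^m+\mathcal O(x^{m+1})$ and $g(x)=bx^n+\mathcal O(x^{n+1})$ as $x\to0$, and suppose that the following conditions for a nilpotent node at the origin hold: $m$ is odd, $a<0$, $n\ge 1$ is even, $b\neq0$, and either $m>2n+1$, or $m=2n+1$ and $b^2+4a(n+1)\ge 0$. Its characteristic curve (the curve through the origin on which $\dot x=0$) is $y=0$. The unit-time map $U=(U_1,U_2)$ (the time-one map of the flow) exists near the origin; let $C_h(x)=U_1(x,0)$ be the characteristic map. Then $$C_h(x)=x+\tfrac a2x^m+\mathcal O(x^{m+1})\qquad (x\to0).$$ Write $\dim_{ch}U=d$ if for every $x_0\ne0$ close to $0$ the orbit $\{C_h^{j}(x_0):j\ge0\}$ has box dimension $d$ (lower and upper box dimension, defined through Minkowski contents, both equal to $d$). The multiplicity of the singular point at the origin is the maximum number of singular points near the origin in $C^\infty$ unfoldings (with finitely many parameters) of the vector field. Then for every integer $k\ge1$ the following are equivalent: (i) $\dim_{ch}U=1-\frac1k$; (ii)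 $C_h(x)=x+\frac a2x^k+\mathcal O(x^{k+1})$ and $\dim_{ch}U=1-\frac1k$; (iii) the origin is a nilpotent singular point of multiplicity $k$. In particular, when the origin is a node (an asymptotically stable singular point, in forward or in backward time, which all nearby nonconstant trajectories enter in a definite direction), (ii) holds if and only if the origin is a $k$-multiple nilpotent node. -/

import Mathlib

open Filter Topology Asymptotics Set MeasureTheory
open scoped ContDiff ENNReal

namespace PlanarSystem

/-! ### Box dimension through Minkowski contents -/

section BoxDimension

variable {E : Type*} [NormedAddCommGroup E] [NormedSpace ℝ E] [MeasureSpace E]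

/-- The quotient `|A_ε| / ε ^ (N - s)`, where `A_ε` is the open `ε`-neighbourhood of `A` and `N` is
the dimension of the space. -/
noncomputable def minkowskiQuotient (A : Set E) (s ε : ℝ) : ℝ≥0∞ :=
  volume (Metric.thickening ε A) / ENNReal.ofReal (ε ^ ((Module.finrank ℝ E : ℝ) - s))

/-- The lower `s`-dimensional Minkowski content. -/
noncomputable def lowerMinkowskiContent (A : Set E) (s : ℝ) : ℝ≥0∞ :=
  liminf (fun ε : ℝ => minkowskiQuotient A s ε) (𝓝[>] 0)

/-- The upper `s`-dimensional Minkowski content. -/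
noncomputable def upperMinkowskiContent (A : Set E) (s : ℝ) : ℝ≥0∞ :=
  limsup (fun ε : ℝ => minkowskiQuotient A s ε) (𝓝[>] 0)

/-- The lower box dimension (of a bounded set). -/
noncomputable def lowerBoxDim (A : Set E) : ℝ :=
  sInf {s : ℝ | 0 < s ∧ lowerMinkowskiContent A s = 0}

/-- The upper box dimension (of a bounded set). -/
noncomputable def upperBoxDim (A : Set E) : ℝ :=
  sInf {s : ℝ | 0 < s ∧ upperMinkowskiContent A s = 0}

/-- The box dimension of the bounded set `A` exists and is equal to `d`. -/
def HasBoxDim (A : Set E) (d : ℝ) : Prop :=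
  Bornology.IsBounded A ∧ lowerBoxDim A = d ∧ upperBoxDim A = d

end BoxDimension

/-! ### Smooth germs and nilpotent singularities -/

/-- `u` is of class `C^∞` on some neighbourhood of the point `x`. -/
def SmoothNear {E F : Type*} [NormedAddCommGroup E] [NormedSpace ℝ E]
    [NormedAddCommGroup F] [NormedSpace ℝ F] (u : E → F) (x : E) : Prop :=
  ∃ s ∈ 𝓝 x, ContDiffOn ℝ ∞ u s

/-- The vector field of the system `x' = y`, `y' = f x + y * g x + y ^ 2 * H (x, y)`. -/
def nodeField (f g : ℝ → ℝ) (H : ℝ × ℝ → ℝ) (p : ℝ × ℝ) : ℝ × ℝ :=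
  (p.2, f p.1 + p.2 * g p.1 + p.2 ^ 2 * H p)

/-- The origin is a nilpotent singularity: the linear part there is nilpotent and not zero. -/
def IsNilpotentSingularity (V : ℝ × ℝ → ℝ × ℝ) : Prop :=
  V 0 = 0 ∧ fderiv ℝ V 0 ≠ 0 ∧ IsNilpotent (fderiv ℝ V 0)

/-- A `C^∞` unfolding, with `l` parameters near `0`, of the germ at the origin of `V`. -/
def IsUnfolding (V : ℝ × ℝ → ℝ × ℝ) (l : ℕ) (W : (Fin l → ℝ) × (ℝ × ℝ) → ℝ × ℝ) : Prop :=
  SmoothNear W 0 ∧ ∀ᶠ p in 𝓝 (0 : ℝ × ℝ), W (0, p) = V p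

/-- The origin is a singular point of `V` of multiplicity (order) `k`: the largest number of
singular points (common zeros of the two components) near the origin in the unfoldings of `V`
is `k`. -/
def HasMultiplicity (V : ℝ × ℝ → ℝ × ℝ) (k : ℕ) : Prop :=
  (∀ (l : ℕ) (W : (Fin l → ℝ) × (ℝ × ℝ) → ℝ × ℝ), IsUnfolding V l W →
    ∃ N ∈ 𝓝 (0 : ℝ × ℝ), ∀ᶠ δ in 𝓝 (0 : Fin l → ℝ), {p ∈ N | W (δ, p) = 0}.encard ≤ k) ∧
  ∃ (l : ℕ) (W : (Fin l → ℝ) × (ℝ × ℝ) → ℝ × ℝ), IsUnfolding V l W ∧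
    ∀ N ∈ 𝓝 (0 : ℝ × ℝ), ∃ᶠ δ in 𝓝 (0 : Fin l → ℝ), (k : ℕ∞) ≤ {p ∈ N | W (δ, p) = 0}.encard

/-- The origin is an attracting node: it is asymptotically stable, and every nonconstant trajectory
near it enters it in a definite direction. -/
def IsAttractingNode (V : ℝ × ℝ → ℝ × ℝ) : Prop :=
  ∀ N ∈ 𝓝 (0 : ℝ × ℝ), ∀ᶠ p in 𝓝 (0 : ℝ × ℝ), ∃ γ : ℝ → ℝ × ℝ,
    γ 0 = p ∧ (∀ t ∈ Ici (0 : ℝ), HasDerivWithinAt γ (V (γ t)) (Ici 0) t ∧ γ t ∈ N) ∧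
    Tendsto γ atTop (𝓝 0) ∧
    (p ≠ 0 → ∃ v : ℝ × ℝ, Tendsto (fun t => ‖γ t‖⁻¹ • γ t) atTop (𝓝 v))

/-- The origin is a node, attracting or repelling. -/
def IsNode (V : ℝ × ℝ → ℝ × ℝ) : Prop :=
  IsAttractingNode V ∨ IsAttractingNode (fun p => -V p)

/-- The origin is a nilpotent singular point of multiplicity `k`. -/
def IsMultipleNilpotentPoint (V : ℝ × ℝ → ℝ × ℝ) (k : ℕ) : Prop :=
  IsNilpotentSingularity V ∧ HasMultiplicity V k

/-- The origin is a `k`-multiple nilpotent node. -/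
def IsMultipleNilpotentNode (V : ℝ × ℝ → ℝ × ℝ) (k : ℕ) : Prop :=
  IsNode V ∧ IsMultipleNilpotentPoint V k

/-! ### Unit-time map, characteristic map, characteristic box dimension -/

/-- `U` is, near the origin, the unit-time map of `V`: the point `p` is sent to the position at time
`1` of the solution that starts at `p`. -/
def IsUnitTimeMap (V U : ℝ × ℝ → ℝ × ℝ) : Prop :=
  ∀ᶠ p in 𝓝 (0 : ℝ × ℝ), ∃ γ : ℝ → ℝ × ℝ, γ 0 = p ∧
    (∀ t ∈ Icc (0 : ℝ) 1, HasDerivWithinAt γ (V (γ t)) (Icc 0 1) t) ∧ U p = γ 1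

/-- The curve `y = φ x` is, near the origin, the characteristic curve of `V`: it passes through the
origin, and it consists of all points where the first component of `V` vanishes. -/
def IsCharacteristicCurve (V : ℝ × ℝ → ℝ × ℝ) (φ : ℝ → ℝ) : Prop :=
  φ 0 = 0 ∧ ∀ᶠ p in 𝓝 (0 : ℝ × ℝ), (V p).1 = 0 ↔ p.2 = φ p.1

/-- The characteristic map: the first component of `U`, restricted to the curve `y = φ x`. -/
def charMap (U : ℝ × ℝ → ℝ × ℝ) (φ : ℝ → ℝ) (x : ℝ) : ℝ :=
  (U (x, φ x)).1

/-- The (forward) orbit of `x` under the map `C`. -/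
def forwardOrbit (C : ℝ → ℝ) (x : ℝ) : Set ℝ :=
  range fun j : ℕ => C^[j] x

/-- The characteristic box dimension exists and is `d`: every orbit of the characteristic map `C`
with initial point close to the origin, other than the origin, has box dimension `d`. -/
def HasCharBoxDim (C : ℝ → ℝ) (d : ℝ) : Prop :=
  ∀ᶠ x in 𝓝[≠] (0 : ℝ), HasBoxDim (forwardOrbit C x) d

/-- `C x = x + (c / 2) * x ^ k + O (x ^ (k + 1))` as `x → 0`. -/
def HasCharForm (C : ℝ → ℝ) (c : ℝ) (k : ℕ) : Prop :=
  (fun x => C x - (x + c / 2 * x ^ k)) =O[𝓝 0] fun x : ℝ => x ^ (k + 1)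

end PlanarSystem

namespace PlanarSystem

/-! All the conditions say the same thing, namely `k = m`: both the multiplicity and the
characteristic box dimension encode the order of vanishing `m` of `f`.

Multiplicity. In any unfolding, the first component of the field still has nonzero `y`-derivative,
so by the inverse function theorem its zeros form a curve over the `x`-axis. The singular points are
then the zeros of one scalar family `h (δ, x)` with `h (0, x) = f x`. Since `f` is not `o (x ^ m)`,
Rolle's theorem allows at most `m` of them (`encard_singularities_le`). Replacing `a x ^ m` by `a ∏
(x - j t)` attains `m` (`frequently_le_encard_splitUnfolding`).

Dimension. A solution starting at `(x, 0)` has acceleration `a x ^ m + O (x ^ (m + 1))` up to time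
one, so integrating twice gives `C x = x + (a / 2) x ^ m + O (x ^ (m + 1))`
(`exists_abs_solution_sub_le`). This estimate holds for every solution, so uniqueness is not needed.
As `a < 0`, orbits of `C` tend to `0` with steps comparable to `x ^ m`. The `ε`-neighbourhood of
such an orbit has length comparable to `ε ^ (1 / m)`, hence the box dimension is `1 - 1 / m`
(`hasBoxDim_range`), a value which determines `m`. -/

/-! ### Counting zeros -/

/-- Rolle's theorem, counting version. -/
theorem encard_zeros_le_of_deriv {F F' : ℝ → ℝ} {I : Set ℝ} (hI : I.OrdConnected)
    (hF : ∀ x ∈ I, HasDerivAt F (F' x) x) {m : ℕ} (h : {x ∈ I | F' x = 0}.encard ≤ m) :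
    {x ∈ I | F x = 0}.encard ≤ (m + 1 : ℕ) := by
  by_contra! hlt
  obtain ⟨t, hts, htc⟩ := Set.exists_subset_encard_eq
    (show ((m + 2 : ℕ) : ℕ∞) ≤ {x ∈ I | F x = 0}.encard by
      have := Order.add_one_le_of_lt hlt
      exact_mod_cast this)
  have htf : t.Finite := Set.finite_of_encard_eq_coe htc
  lift t to Finset ℝ using htf
  rw [Set.encard_coe_eq_coe_finsetCard] at htc
  have hc : t.card = m + 2 := by exact_mod_cast htc
  let e := t.orderEmbOfFin hc
  have he : ∀ i, e i ∈ I ∧ F (e i) = 0 := fun i => hts (t.orderEmbOfFin_mem hc i)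
  have key : ∀ i : Fin (m + 1), ∃ c ∈ Ioo (e i.castSucc) (e i.succ), F' c = 0 := by
    intro i
    have hsub : Icc (e i.castSucc) (e i.succ) ⊆ I := hI.out (he _).1 (he _).1
    exact exists_hasDerivAt_eq_zero (e.strictMono (Fin.castSucc_lt_succ))
      (fun x hx => (hF x (hsub hx)).continuousAt.continuousWithinAt)
      ((he _).2.trans (he _).2.symm) (fun x hx => hF x (hsub (Ioo_subset_Icc_self hx)))
  choose c hc hc0 using key
  have hmono : StrictMono c := by
    intro i j hij
    refine (hc i).2.trans_le (le_trans ?_ (hc j).1.le)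
    exact e.monotone (Fin.succ_le_castSucc_iff.2 hij)
  have hsub : range c ⊆ {x ∈ I | F' x = 0} := by
    rintro _ ⟨i, rfl⟩
    exact ⟨hI.out (he i.castSucc).1 (he i.succ).1 (Ioo_subset_Icc_self (hc i)), hc0 i⟩
  have := (Set.encard_le_encard hsub).trans h
  rw [← Set.image_univ, hmono.injective.encard_image, Set.encard_univ] at this
  simp only [ENat.card_eq_coe_fintype_card, Fintype.card_fin] at this
  exact absurd (by exact_mod_cast this : m + 1 ≤ m) (by omega)

/-- If the derivative is `o (x ^ m)`, a function vanishing at `0` is `o (x ^ (m + 1))`. -/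
theorem isLittleO_pow_succ_of_deriv {F F' : ℝ → ℝ} {m : ℕ}
    (hF : ∀ᶠ x in 𝓝 0, HasDerivAt F (F' x) x) (h0 : F 0 = 0)
    (h : F' =o[𝓝 0] fun x : ℝ => x ^ m) : F =o[𝓝 0] fun x : ℝ => x ^ (m + 1) := by
  rw [isLittleO_iff] at h ⊢
  intro c hc
  obtain ⟨r, hr, hball⟩ := Metric.eventually_nhds_iff_ball.1 (hF.and (h hc))
  filter_upwards [Metric.ball_mem_nhds (0 : ℝ) hr] with x hx
  have hsub : ∀ z ∈ Metric.closedBall (0 : ℝ) |x|, z ∈ Metric.ball (0 : ℝ) r ∧ |z| ≤ |x| := by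
    intro z hz
    have hz' : |z| ≤ |x| := by simpa using hz
    exact ⟨by simpa using hz'.trans_lt (by simpa using hx), hz'⟩
  have := (convex_closedBall (0 : ℝ) |x|).norm_image_sub_le_of_norm_hasDerivWithin_le
    (f := F) (f' := F') (C := c * |x| ^ m) (x := 0) (y := x)
    (fun z hz => (hball z (hsub z hz).1).1.hasDerivWithinAt)
    (fun z hz => by
      refine (hball z (hsub z hz).1).2.trans ?_
      rw [norm_pow, Real.norm_eq_abs]
      have := (hsub z hz).2
      gcongr) (by simp) (by simp)
  rw [h0, sub_zero, sub_zero, Real.norm_eq_abs x] at this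
  rw [norm_pow, Real.norm_eq_abs x, pow_succ, ← mul_assoc]
  exact this

/-- A `C ^ m` family of functions of one variable whose central member is not `o (x ^ m)` has,
uniformly in the parameter, at most `m` zeros near the origin. -/
theorem exists_encard_zeros_le {P : Type*} [NormedAddCommGroup P] [NormedSpace ℝ P] {m : ℕ}
    {h : P × ℝ → ℝ} (hh : ContDiffAt ℝ m h 0)
    (hflat : ¬ (fun x => h (0, x)) =o[𝓝 0] fun x : ℝ => x ^ m) :
    ∃ r > 0, ∀ δ : P, ‖δ‖ < r → {x ∈ Ioo (-r) r | h (δ, x) = 0}.encard ≤ m := by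
  have nonzero : ∀ h : P × ℝ → ℝ, ContinuousAt h 0 → h 0 ≠ 0 →
      ∃ r > 0, ∀ δ : P, ‖δ‖ < r → {x ∈ Ioo (-r) r | h (δ, x) = 0} = ∅ := by
    intro h hc h0
    obtain ⟨r, hr, hb⟩ := Metric.eventually_nhds_iff_ball.1 (hc.eventually_ne h0)
    refine ⟨r, hr, fun δ hδ => ?_⟩
    ext x
    simp only [mem_ofPred_eq, mem_empty_iff_false, iff_false, not_and]
    intro hx
    refine hb _ ?_
    rw [mem_ball_zero_iff, Prod.norm_def, max_lt_iff]
    exact ⟨hδ, abs_lt.2 hx⟩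
  induction m generalizing h with
  | zero =>
    obtain ⟨r, hr, hb⟩ := nonzero h hh.continuousAt fun h0 => hflat (by
      simp only [pow_zero, isLittleO_one_iff]
      have : ContinuousAt (fun x : ℝ => h (0, x)) 0 :=
        ContinuousAt.comp (f := fun x : ℝ => ((0 : P), x)) (g := h) hh.continuousAt (by fun_prop)
      simpa [ContinuousAt, Prod.mk_zero_zero, h0] using this)
    exact ⟨r, hr, fun δ hδ => by rw [hb δ hδ, encard_empty]; exact zero_le⟩
  | succ m ih =>
    -- If `h 0 = 0`, the `x`-derivative of the central member cannot be `o (x ^ m)`, since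
    -- integrating would make that member `o (x ^ (m + 1))`. The induction hypothesis therefore
    -- applies to the derivative, and Rolle adds one zero.
    by_cases h0 : h 0 = 0
    · let h' : P × ℝ → ℝ := fun q => fderiv ℝ h q (0, 1)
      have hd : ∀ᶠ q in 𝓝 (0 : P × ℝ), HasDerivAt (fun x => h (q.1, x)) (h' q) q.2 := by
        filter_upwards [hh.eventually (by simp)] with q hq
        have h1 := (hq.differentiableAt (by simp)).hasFDerivAt
        exact h1.comp_hasDerivAt_of_eq q.2
          ((hasDerivAt_const q.2 q.1).prodMk (hasDerivAt_id q.2)) rfl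
      have hh' : ContDiffAt ℝ m h' 0 :=
        (hh.fderiv_right (m := m) (by norm_cast)).clm_apply contDiffAt_const
      have hslice : Tendsto (fun x : ℝ => ((0 : P), x)) (𝓝 0) (𝓝 0) :=
        Continuous.tendsto' (by fun_prop) _ _ rfl
      obtain ⟨r₁, hr₁, hb₁⟩ := ih hh' fun hl => hflat
        (isLittleO_pow_succ_of_deriv (hslice.eventually hd) h0 hl)
      obtain ⟨r₂, hr₂, hb₂⟩ := Metric.eventually_nhds_iff_ball.1 hd
      refine ⟨min r₁ r₂, lt_min hr₁ hr₂, fun δ hδ => ?_⟩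
      obtain ⟨hδ₁, hδ₂⟩ := lt_min_iff.1 hδ
      refine encard_zeros_le_of_deriv (F' := fun x => h' (δ, x)) ordConnected_Ioo
        (fun x hx => hb₂ (δ, x) ?_)
        ((Set.encard_le_encard fun x hx => And.intro ?_ hx.2).trans (hb₁ δ hδ₁))
      · rw [mem_ball_zero_iff, Prod.norm_def, max_lt_iff]
        exact ⟨hδ₂, (abs_lt.2 hx).trans_le (min_le_right _ _)⟩
      · exact abs_lt.1 ((abs_lt.2 hx.1).trans_le (min_le_left _ _))
    · obtain ⟨r, hr, hb⟩ := nonzero h hh.continuousAt h0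
      exact ⟨r, hr, fun δ hδ => by rw [hb δ hδ, encard_empty]; exact zero_le⟩

/-- A function with leading term `a x ^ m`, `a ≠ 0`, is not `o (x ^ m)`. -/
theorem not_isLittleO_pow {f : ℝ → ℝ} {a : ℝ} {m : ℕ} (ha : a ≠ 0)
    (hf : (fun x => f x - a * x ^ m) =O[𝓝 0] fun x : ℝ => x ^ (m + 1)) :
    ¬ f =o[𝓝 0] fun x : ℝ => x ^ m := by
  intro h
  have h1 : (fun x : ℝ => x ^ (m + 1)) =o[𝓝 0] fun x : ℝ => x ^ m :=
    isLittleO_pow_pow (Nat.lt_succ_self m)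
  have h2 : (fun x : ℝ => a * x ^ m) =o[𝓝 0] fun x : ℝ => x ^ m := by
    simpa using h.sub (hf.trans_isLittleO h1)
  have h3 := (isLittleO_const_mul_left_iff ha).1 h2
  obtain ⟨x, hx, hx0⟩ := (((isLittleO_iff.1 h3 (half_pos one_pos)).filter_mono
    (nhdsWithin_le_nhds (s := {0}ᶜ))).and self_mem_nhdsWithin).exists
  have : 0 < ‖x ^ m‖ := norm_pos_iff.2 (pow_ne_zero m hx0)
  linarith

/-! ### Smooth germs -/

section SmoothNear

variable {E F : Type*} [NormedAddCommGroup E] [NormedSpace ℝ E] [NormedAddCommGroup F]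
  [NormedSpace ℝ F]

theorem smoothNear_iff_eventually {u : E → F} {x : E} :
    SmoothNear u x ↔ ∀ᶠ z in 𝓝 x, ContDiffAt ℝ ∞ u z := by
  constructor
  · rintro ⟨s, hs, hu⟩
    filter_upwards [eventually_mem_nhds_iff.2 hs] with z hz
    exact hu.contDiffAt hz
  · intro h
    exact ⟨_, h, fun z hz => ContDiffAt.contDiffWithinAt hz⟩

theorem SmoothNear.contDiffAt {u : E → F} {x : E} (h : SmoothNear u x) : ContDiffAt ℝ ∞ u x :=
  (smoothNear_iff_eventually.1 h).self_of_nhds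

end SmoothNear

/-! ### The upper bound for the multiplicity -/

/-- The invertible linear map `(δ, x, y) ↦ (δ, x, w (δ, x, y))`, where `w (0, x, y) = y`. -/
noncomputable def shearEquiv {P : Type*} [NormedAddCommGroup P] [NormedSpace ℝ P]
    (w : P × (ℝ × ℝ) →L[ℝ] ℝ) (hw : ∀ p : ℝ × ℝ, w (0, p) = p.2) :
    (P × (ℝ × ℝ)) ≃L[ℝ] (P × (ℝ × ℝ)) :=
  ContinuousLinearEquiv.equivOfInverse
    ((ContinuousLinearMap.fst ℝ P (ℝ × ℝ)).prod
      ((ContinuousLinearMap.fst ℝ ℝ ℝ ∘L ContinuousLinearMap.snd ℝ P (ℝ × ℝ)).prod w))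
    ((ContinuousLinearMap.fst ℝ P (ℝ × ℝ)).prod
      ((ContinuousLinearMap.fst ℝ ℝ ℝ ∘L ContinuousLinearMap.snd ℝ P (ℝ × ℝ)).prod
        (ContinuousLinearMap.snd ℝ ℝ ℝ ∘L ContinuousLinearMap.snd ℝ P (ℝ × ℝ) -
          w ∘L ContinuousLinearMap.inl ℝ P (ℝ × ℝ) ∘L ContinuousLinearMap.fst ℝ P (ℝ × ℝ))))
    (by
      rintro ⟨δ, p⟩
      have : w (δ, p) = w (δ, 0) + p.2 := by
        rw [← hw p, ← map_add]
        simp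
      simp [this])
    (by
      rintro ⟨δ, x, z⟩
      have : w (δ, (x, z - w (δ, 0))) = z := by
        have h := map_add w (δ, 0) (0, (x, z - w (δ, 0)))
        rw [hw] at h
        simpa using h
      simp [this])

/-- Taking the first component of `W` as a coordinate in place of `y` puts all singular points on a
coordinate plane, where they are determined by `(δ, x)`. What remains is to count zeros of the
second component restricted to that plane. -/
theorem encard_singularities_le {l m : ℕ} {V : ℝ × ℝ → ℝ × ℝ}
    {W : (Fin l → ℝ) × (ℝ × ℝ) → ℝ × ℝ} (hW : IsUnfolding V l W)
    (hV : ∀ᶠ p in 𝓝 (0 : ℝ × ℝ), (V p).1 = p.2)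
    (hflat : ¬ (fun x : ℝ => (V (x, 0)).2) =o[𝓝 0] fun x : ℝ => x ^ m) :
    ∃ N ∈ 𝓝 (0 : ℝ × ℝ), ∀ᶠ δ in 𝓝 (0 : Fin l → ℝ), {p ∈ N | W (δ, p) = 0}.encard ≤ m := by
  obtain ⟨hWs, hWV⟩ := hW
  have hWc : ContDiffAt ℝ ∞ W 0 := hWs.contDiffAt
  set w := fderiv ℝ (fun q => (W q).1) 0 with hw_def
  have hw1 : HasFDerivAt (fun q => (W q).1) w 0 :=
    ((contDiffAt_fst.comp 0 hWc).differentiableAt (by simp)).hasFDerivAt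
  have hw : ∀ p : ℝ × ℝ, w (0, p) = p.2 := by
    have h1 : HasFDerivAt (fun p : ℝ × ℝ => (W ((0 : Fin l → ℝ), p)).1)
        (w ∘L ContinuousLinearMap.inr ℝ (Fin l → ℝ) (ℝ × ℝ)) 0 :=
      HasFDerivAt.comp (g := fun q => (W q).1) (f := fun p : ℝ × ℝ => ((0 : Fin l → ℝ), p)) 0 hw1
        (hasFDerivAt_prodMk_right _ _)
    have h2 : HasFDerivAt (fun p : ℝ × ℝ => (W ((0 : Fin l → ℝ), p)).1)
        (ContinuousLinearMap.snd ℝ ℝ ℝ) 0 := by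
      refine hasFDerivAt_snd.congr_of_eventuallyEq ?_
      filter_upwards [hWV, hV] with p h3 h4
      rw [h3, h4]
    intro p
    simpa using DFunLike.congr_fun (h1.unique h2) p
  let Φ : (Fin l → ℝ) × (ℝ × ℝ) → (Fin l → ℝ) × (ℝ × ℝ) := fun q => (q.1, (q.2.1, (W q).1))
  have hΦc : ContDiffAt ℝ ∞ Φ 0 :=
    contDiffAt_fst.prodMk ((contDiffAt_fst.comp 0 contDiffAt_snd).prodMk
      (contDiffAt_fst.comp 0 hWc))
  have hΦd : HasFDerivAt Φ (shearEquiv w hw : _ →L[ℝ] _) 0 :=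
    hasFDerivAt_fst.prodMk ((hasFDerivAt_fst.comp 0 hasFDerivAt_snd).prodMk hw1)
  let Ψ := hΦc.localInverse hΦd (by simp)
  have hΨΦ : ∀ᶠ q in 𝓝 0, Ψ (Φ q) = q :=
    (hΦc.hasStrictFDerivAt' hΦd (by simp)).eventually_left_inverse
  have hV0 : (V 0).1 = 0 := hV.self_of_nhds
  have hΦ0 : Φ 0 = 0 := by
    have : W 0 = V 0 := hWV.self_of_nhds
    simp only [Φ, this, hV0]
    rfl
  have hΨ0 : Ψ 0 = 0 := by simpa [hΦ0] using hΨΦ.self_of_nhds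
  have hΨc : ContDiffAt ℝ ∞ Ψ 0 := by
    have := hΦc.to_localInverse hΦd (by simp)
    rwa [hΦ0] at this
  let h : (Fin l → ℝ) × ℝ → ℝ := fun q => (W (Ψ (q.1, (q.2, 0)))).2
  have hh : ContDiffAt ℝ m h 0 := by
    have h1 : ContDiffAt ℝ ∞ (fun q : (Fin l → ℝ) × ℝ => (q.1, (q.2, (0 : ℝ)))) 0 := by fun_prop
    have h2 : ContDiffAt ℝ ∞ (fun q : (Fin l → ℝ) × ℝ => Ψ (q.1, (q.2, (0 : ℝ)))) 0 :=
      ContDiffAt.comp (g := Ψ) (0 : (Fin l → ℝ) × ℝ) hΨc h1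
    have h3 : ContDiffAt ℝ ∞ (fun q : (Fin l → ℝ) × ℝ => W (Ψ (q.1, (q.2, (0 : ℝ))))) 0 := by
      refine ContDiffAt.comp (g := W) (0 : (Fin l → ℝ) × ℝ) ?_ h2
      change ContDiffAt ℝ ∞ W (Ψ 0)
      rwa [hΨ0]
    exact (contDiffAt_snd.comp (0 : (Fin l → ℝ) × ℝ) h3).of_le (mod_cast le_top)
  have hslice : Tendsto (fun x : ℝ => ((0 : Fin l → ℝ), (x, (0 : ℝ)))) (𝓝 0) (𝓝 0) :=
    Continuous.tendsto' (by fun_prop) _ _ rfl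
  have hslice' : Tendsto (fun x : ℝ => (x, (0 : ℝ))) (𝓝 0) (𝓝 0) :=
    Continuous.tendsto' (by fun_prop) _ _ rfl
  -- For `δ = 0` the new coordinate is `y` itself, so `Ψ` fixes the points `(0, (x, 0))`.
  have hh0 : (fun x => h (0, x)) =ᶠ[𝓝 0] fun x : ℝ => (V (x, 0)).2 := by
    filter_upwards [hslice.eventually hΨΦ, hslice'.eventually hWV, hslice'.eventually hV]
      with x h1 h2 h3
    have : Φ (0, (x, 0)) = (0, (x, 0)) := by simp only [Φ, h2, h3]
    rw [this] at h1
    simp only [h, h1, h2]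
  obtain ⟨r₁, hr₁, hb₁⟩ := exists_encard_zeros_le hh fun hl => hflat (hl.congr' hh0 .rfl)
  obtain ⟨r₂, hr₂, hb₂⟩ := Metric.eventually_nhds_iff_ball.1 hΨΦ
  refine ⟨Metric.ball 0 (min r₁ r₂), Metric.ball_mem_nhds _ (lt_min hr₁ hr₂), ?_⟩
  filter_upwards [Metric.ball_mem_nhds (0 : Fin l → ℝ) (lt_min hr₁ hr₂)] with δ hδ
  rw [mem_ball_zero_iff, lt_min_iff] at hδ
  have key : ∀ p ∈ {p ∈ Metric.ball (0 : ℝ × ℝ) (min r₁ r₂) | W (δ, p) = 0},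
      Ψ (δ, (p.1, 0)) = (δ, p) := by
    rintro p ⟨hp, hp0⟩
    rw [mem_ball_zero_iff, lt_min_iff] at hp
    have := hb₂ (δ, p) (by
      rw [mem_ball_zero_iff, Prod.norm_def, max_lt_iff]
      exact ⟨hδ.2, hp.2⟩)
    simpa only [Φ, hp0, Prod.fst_zero] using this
  have hinj : InjOn Prod.fst {p ∈ Metric.ball (0 : ℝ × ℝ) (min r₁ r₂) | W (δ, p) = 0} := by
    intro p hp q hq hpq
    have h1 := key p hp
    rw [hpq, key q hq] at h1
    exact (congrArg Prod.snd h1).symm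
  rw [← hinj.encard_image]
  refine (Set.encard_le_encard ?_).trans (hb₁ δ hδ.1)
  rintro _ ⟨p, hp, rfl⟩
  refine ⟨?_, ?_⟩
  · have := hp.1
    rw [mem_ball_zero_iff, lt_min_iff, Prod.norm_def, max_lt_iff] at this
    exact abs_lt.1 this.1.1
  · simp only [h, key p hp, hp.2, Prod.snd_zero]

/-! ### An unfolding with the largest number of singular points -/

/-- Between `i - 1/2` and `i + 1/2` only the factor with `j = i` changes sign; the others have `|i -
j| ≥ 1`. -/
theorem prod_nodes_mul_neg {m : ℕ} (i : Fin m) :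
    (∏ j : Fin m, ((i : ℝ) - 1 / 2 - (j : ℝ))) * ∏ j : Fin m, ((i : ℝ) + 1 / 2 - (j : ℝ)) < 0 := by
  rw [← Finset.prod_mul_distrib, ← Finset.mul_prod_erase _ _ (Finset.mem_univ i)]
  refine mul_neg_of_neg_of_pos (by nlinarith) (Finset.prod_pos fun j hj => ?_)
  have hne : (i : ℕ) ≠ j := fun h => (Finset.ne_of_mem_erase hj) (Fin.ext h.symm)
  rcases lt_or_gt_of_ne hne with h | h
  · have : (i : ℝ) + 1 ≤ j := by exact_mod_cast h
    nlinarith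
  · have : (j : ℝ) + 1 ≤ i := by exact_mod_cast h
    nlinarith

/-- Splitting the zero of `a x ^ m` into `m` simple zeros at `0, t, …, (m - 1) t`. -/
noncomputable def splitZero (a : ℝ) (m : ℕ) (t x : ℝ) : ℝ :=
  a * (∏ j : Fin m, (x - j * t) - x ^ m)

theorem splitZero_zero (a : ℝ) (m : ℕ) (x : ℝ) : splitZero a m 0 x = 0 := by
  simp [splitZero]

/-- The unfolding of the system that splits the zero of `f`. -/
noncomputable def splitUnfolding (f g : ℝ → ℝ) (H : ℝ × ℝ → ℝ) (a : ℝ) (m : ℕ)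
    (q : (Fin 1 → ℝ) × (ℝ × ℝ)) : ℝ × ℝ :=
  nodeField (fun x => f x + splitZero a m (q.1 0) x) g H q.2

theorem isUnfolding_splitUnfolding {f g : ℝ → ℝ} {H : ℝ × ℝ → ℝ} (a : ℝ) (m : ℕ)
    (hf : SmoothNear f 0) (hg : SmoothNear g 0) (hH : SmoothNear H 0) :
    IsUnfolding (nodeField f g H) 1 (splitUnfolding f g H a m) := by
  refine ⟨?_, Eventually.of_forall fun p => ?_⟩
  · rw [smoothNear_iff_eventually] at *
    have h1 : Tendsto (fun q : (Fin 1 → ℝ) × (ℝ × ℝ) => q.2.1) (𝓝 0) (𝓝 0) :=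
      Continuous.tendsto' (by fun_prop) _ _ rfl
    have h2 : Tendsto (fun q : (Fin 1 → ℝ) × (ℝ × ℝ) => q.2) (𝓝 0) (𝓝 0) :=
      Continuous.tendsto' (by fun_prop) _ _ rfl
    filter_upwards [h1.eventually hf, h1.eventually hg, h2.eventually hH] with q hfq hgq hHq
    have hx : ContDiffAt ℝ ∞ (fun q : (Fin 1 → ℝ) × (ℝ × ℝ) => q.2.1) q := by fun_prop
    have hf' := ContDiffAt.comp (g := f) q hfq hx
    have hg' := ContDiffAt.comp (g := g) q hgq hx
    have hH' := ContDiffAt.comp (g := H) q hHq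
      (contDiffAt_snd : ContDiffAt ℝ ∞ (fun q : (Fin 1 → ℝ) × (ℝ × ℝ) => q.2) q)
    have hs : ContDiffAt ℝ ∞
        (fun q : (Fin 1 → ℝ) × (ℝ × ℝ) => splitZero a m (q.1 0) q.2.1) q := by
      refine contDiffAt_const.mul (ContDiffAt.sub (contDiffAt_prod fun j _ => ?_) (by fun_prop))
      fun_prop
    have hy : ContDiffAt ℝ ∞ (fun q : (Fin 1 → ℝ) × (ℝ × ℝ) => q.2.2) q := by fun_prop
    exact hy.prodMk (((hf'.add hs).add (hy.mul hg')).add ((hy.pow 2).mul hH'))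
  · simp [splitUnfolding, nodeField, splitZero_zero]

/-- In the scale `x = c t`, the perturbed function divided by `t ^ m` tends to `a ∏ (c - j)`,
because the remainder of `f` is of higher order. The sign changes of the limit between consecutive
half-integers persist for small `t > 0`, and each yields a singular point on `y = 0`. -/
theorem frequently_le_encard_splitUnfolding {f g : ℝ → ℝ} {H : ℝ × ℝ → ℝ} {a : ℝ} {m : ℕ}
    (ha : a ≠ 0) (hfs : SmoothNear f 0)
    (hf : (fun x => f x - a * x ^ m) =O[𝓝 0] fun x : ℝ => x ^ (m + 1))
    {N : Set (ℝ × ℝ)} (hN : N ∈ 𝓝 (0 : ℝ × ℝ)) :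
    ∃ᶠ δ in 𝓝 (0 : Fin 1 → ℝ), (m : ℕ∞) ≤ {p ∈ N | splitUnfolding f g H a m (δ, p) = 0}.encard := by
  have hpar : Tendsto (fun t : ℝ => (fun _ => t : Fin 1 → ℝ)) (𝓝[>] 0) (𝓝 0) :=
    (Continuous.tendsto' (by fun_prop) _ _ rfl).mono_left nhdsWithin_le_nhds
  refine hpar.frequently (Eventually.frequently ?_)
  let F : ℝ → ℝ → ℝ := fun t x => f x + splitZero a m t x
  have hlim : ∀ c : ℝ, Tendsto (fun t => F t (c * t) / t ^ m) (𝓝[>] 0)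
      (𝓝 (a * ∏ j : Fin m, (c - j))) := by
    intro c
    have hct : Tendsto (fun t : ℝ => c * t) (𝓝[>] 0) (𝓝 0) :=
      (Continuous.tendsto' (by fun_prop) _ _ (by simp)).mono_left nhdsWithin_le_nhds
    have h1 : (fun t : ℝ => f (c * t) - a * (c * t) ^ m) =o[𝓝[>] 0] fun t : ℝ => t ^ m := by
      refine ((hf.comp_tendsto hct).trans_isLittleO ?_)
      have : (fun t : ℝ => c ^ (m + 1) * t ^ (m + 1)) =o[𝓝[>] 0] fun t : ℝ => t ^ m :=
        ((isLittleO_pow_pow (Nat.lt_succ_self m)).const_mul_left _).mono nhdsWithin_le_nhds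
      simpa [Function.comp_def, mul_pow] using this
    have h2 := h1.tendsto_div_nhds_zero.add_const (a * ∏ j : Fin m, (c - j))
    rw [zero_add] at h2
    refine h2.congr' ?_
    filter_upwards [self_mem_nhdsWithin] with t (ht : 0 < t)
    have hp : ∏ j : Fin m, (c * t - j * t) = (∏ j : Fin m, (c - j)) * t ^ m := by
      simp_rw [← sub_mul, Finset.prod_mul_distrib]
      simp
    simp only [F, splitZero, hp]
    field_simp
    ring
  have hsign : ∀ᶠ t in 𝓝[>] (0 : ℝ), ∀ i : Fin m,
      F t (((i : ℝ) - 1 / 2) * t) * F t (((i : ℝ) + 1 / 2) * t) < 0 := by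
    rw [Filter.eventually_all]
    intro i
    have hneg : (a * ∏ j : Fin m, ((i : ℝ) - 1 / 2 - (j : ℝ))) *
        (a * ∏ j : Fin m, ((i : ℝ) + 1 / 2 - (j : ℝ))) < 0 := by
      have := prod_nodes_mul_neg i
      rw [mul_mul_mul_comm]
      exact mul_neg_of_pos_of_neg (mul_self_pos.2 ha) this
    filter_upwards [((hlim _).mul (hlim _)).eventually_lt_const hneg, self_mem_nhdsWithin]
      with t ht (ht0 : 0 < t)
    rw [div_mul_div_comm, div_lt_iff₀ (by positivity), zero_mul] at ht
    exact ht
  obtain ⟨r, hr, hcont⟩ : ∃ r > 0, ∀ x : ℝ, |x| < r → ContinuousAt f x := by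
    obtain ⟨r, hr, hb⟩ := Metric.eventually_nhds_iff_ball.1 (smoothNear_iff_eventually.1 hfs)
    exact ⟨r, hr, fun x hx => (hb x (by simpa using hx)).continuousAt⟩
  obtain ⟨r', hr', hN'⟩ := Metric.mem_nhds_iff.1 hN
  have hsmall : ∀ᶠ t in 𝓝[>] (0 : ℝ), ((m : ℝ) + 1) * t < min r r' :=
    (((Continuous.tendsto' (by fun_prop) _ _ (by simp) :
      Tendsto (fun t : ℝ => ((m : ℝ) + 1) * t) (𝓝 0) (𝓝 0)).eventually_lt_const
        (lt_min hr hr')).filter_mono nhdsWithin_le_nhds)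
  filter_upwards [hsign, hsmall, self_mem_nhdsWithin] with t hs hsm (ht : 0 < t)
  rw [lt_min_iff] at hsm
  have habs : ∀ i : Fin m, ∀ x ∈ Icc (((i : ℝ) - 1 / 2) * t) (((i : ℝ) + 1 / 2) * t),
      |x| < (m + 1) * t := by
    intro i x hx
    have hi : (i : ℝ) + 1 ≤ m := by exact_mod_cast i.2
    have hi0 : (0 : ℝ) ≤ i := by positivity
    rw [abs_lt]
    constructor
    · nlinarith [hx.1]
    · nlinarith [hx.2]
  have hzero : ∀ i : Fin m, ∃ x ∈ Ioo (((i : ℝ) - 1 / 2) * t) (((i : ℝ) + 1 / 2) * t),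
      F t x = 0 := by
    intro i
    have hle : ((i : ℝ) - 1 / 2) * t ≤ ((i : ℝ) + 1 / 2) * t := by nlinarith
    have hc : ContinuousOn (F t) (Icc (((i : ℝ) - 1 / 2) * t) (((i : ℝ) + 1 / 2) * t)) := by
      intro x hx
      have h1 := hcont x ((habs i x hx).trans hsm.1)
      have h2 : ContinuousAt (fun x => splitZero a m t x) x := by
        unfold splitZero
        fun_prop
      exact (h1.add h2).continuousWithinAt
    rcases mul_neg_iff.1 (hs i) with ⟨h1, h2⟩ | ⟨h1, h2⟩
    · obtain ⟨x, hx, hx0⟩ := intermediate_value_Ioo' hle hc ⟨h2, h1⟩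
      exact ⟨x, hx, hx0⟩
    · obtain ⟨x, hx, hx0⟩ := intermediate_value_Ioo hle hc ⟨h1, h2⟩
      exact ⟨x, hx, hx0⟩
  choose z hz hz0 using hzero
  have hzmono : StrictMono z := by
    intro i j hij
    have h1 : (i : ℝ) + 1 ≤ j := by exact_mod_cast hij
    have h2 := (hz i).2
    have h3 := (hz j).1
    nlinarith
  have hinj : Function.Injective fun i => (z i, (0 : ℝ)) := fun i j hij =>
    hzmono.injective (congrArg Prod.fst hij)
  have hcard : (m : ℕ∞) = (range fun i => (z i, (0 : ℝ))).encard := by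
    rw [← Set.image_univ, hinj.encard_image, Set.encard_univ]
    simp
  rw [hcard]
  refine Set.encard_le_encard ?_
  rintro _ ⟨i, rfl⟩
  refine ⟨hN' ?_, ?_⟩
  · rw [mem_ball_zero_iff, Prod.norm_def, max_lt_iff]
    exact ⟨(habs i _ (Ioo_subset_Icc_self (hz i))).trans hsm.2, by simpa using hr'⟩
  · have : f (z i) + splitZero a m t (z i) = 0 := hz0 i
    simp [splitUnfolding, nodeField, this]

/-- The multiplicity of the origin is the order of vanishing of `f`. -/
theorem hasMultiplicity_nodeField_iff {f g : ℝ → ℝ} {H : ℝ × ℝ → ℝ} {a : ℝ} {m : ℕ} (ha : a ≠ 0)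
    (hfs : SmoothNear f 0) (hgs : SmoothNear g 0) (hHs : SmoothNear H 0)
    (hf : (fun x => f x - a * x ^ m) =O[𝓝 0] fun x : ℝ => x ^ (m + 1)) (k : ℕ) :
    HasMultiplicity (nodeField f g H) k ↔ k = m := by
  have hupper : ∀ (l : ℕ) (W : (Fin l → ℝ) × (ℝ × ℝ) → ℝ × ℝ), IsUnfolding (nodeField f g H) l W →
      ∃ N ∈ 𝓝 (0 : ℝ × ℝ), ∀ᶠ δ in 𝓝 (0 : Fin l → ℝ), {p ∈ N | W (δ, p) = 0}.encard ≤ m :=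
    fun l W hW => encard_singularities_le hW (Eventually.of_forall fun p => rfl)
      (by simpa [nodeField] using not_isLittleO_pow ha hf)
  have hunf := isUnfolding_splitUnfolding a m hfs hgs hHs
  constructor
  · rintro ⟨h1, l, W, hW, h2⟩
    apply le_antisymm
    · obtain ⟨N, hN, hle⟩ := hupper l W hW
      obtain ⟨δ, hδ1, hδ2⟩ := ((h2 N hN).and_eventually hle).exists
      exact_mod_cast hδ1.trans hδ2
    · obtain ⟨N, hN, hle⟩ := h1 1 _ hunf
      obtain ⟨δ, hδ1, hδ2⟩ :=
        ((frequently_le_encard_splitUnfolding ha hfs hf hN).and_eventually hle).exists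
      exact_mod_cast hδ1.trans hδ2
  · rintro rfl
    exact ⟨hupper, 1, _, hunf, fun N hN => frequently_le_encard_splitUnfolding ha hfs hf hN⟩

/-! ### Box dimension of subsets of the line -/

/-- The Minkowski quotient is comparable to `ε ^ (s - d)`: it tends to `0` for `s > d` and stays
above `c` for `s ≤ d`. Both sets of exponents are thus `Ioi d`; as `d > 0`, the constraint `0 < s`
removes nothing. -/
theorem hasBoxDim_of_volume_thickening {A : Set ℝ} {d c C : ℝ} (hA : Bornology.IsBounded A)
    (hd : 0 < d) (hc : 0 < c)
    (hle : ∀ᶠ ε in 𝓝[>] (0 : ℝ),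
      volume (Metric.thickening ε A) ≤ ENNReal.ofReal (C * ε ^ (1 - d)))
    (hge : ∀ᶠ ε in 𝓝[>] (0 : ℝ),
      ENNReal.ofReal (c * ε ^ (1 - d)) ≤ volume (Metric.thickening ε A)) :
    HasBoxDim A d := by
  have hquot : ∀ s : ℝ, ∀ ε : ℝ, 0 < ε → ∀ K : ℝ,
      ENNReal.ofReal (K * ε ^ (1 - d)) / ENNReal.ofReal (ε ^ (1 - s)) =
        ENNReal.ofReal (K * ε ^ (s - d)) := by
    intro s ε hε K
    rw [← ENNReal.ofReal_div_of_pos (Real.rpow_pos_of_pos hε _), mul_div_assoc,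
      ← Real.rpow_sub hε]
    ring_nf
  have hzero : ∀ s, d < s → Tendsto (fun ε : ℝ => minkowskiQuotient A s ε) (𝓝[>] 0) (𝓝 0) := by
    intro s hs
    have h1 : Tendsto (fun ε : ℝ => ENNReal.ofReal (C * ε ^ (s - d))) (𝓝[>] 0) (𝓝 0) := by
      have h2 : Tendsto (fun ε : ℝ => C * ε ^ (s - d)) (𝓝 0) (𝓝 0) := by
        have := (Real.continuousAt_rpow_const 0 (s - d) (Or.inr (sub_pos.2 hs).le)).const_mul C
          |>.tendsto
        rwa [Real.zero_rpow (sub_pos.2 hs).ne', mul_zero] at this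
      have := (ENNReal.tendsto_ofReal h2).mono_left (nhdsWithin_le_nhds (s := Ioi 0))
      rwa [ENNReal.ofReal_zero] at this
    refine tendsto_of_tendsto_of_tendsto_of_le_of_le' tendsto_const_nhds h1
      (Eventually.of_forall fun _ => zero_le) ?_
    filter_upwards [hle, self_mem_nhdsWithin] with ε h hε
    rw [← hquot s ε hε, minkowskiQuotient, Module.finrank_self, Nat.cast_one]
    gcongr
  have hpos : ∀ s, s ≤ d → 0 < lowerMinkowskiContent A s := by
    intro s hs
    refine (ENNReal.ofReal_pos.2 hc).trans_le (le_liminf_of_le (by isBoundedDefault) ?_)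
    filter_upwards [hge, Ioo_mem_nhdsGT one_pos] with ε h hε
    rw [minkowskiQuotient, Module.finrank_self, Nat.cast_one]
    calc ENNReal.ofReal c ≤ ENNReal.ofReal (c * ε ^ (s - d)) := by
          gcongr
          exact le_mul_of_one_le_right hc.le
            (Real.one_le_rpow_of_pos_of_le_one_of_nonpos hε.1 hε.2.le (by linarith))
      _ = _ := (hquot s ε hε.1 c).symm
      _ ≤ _ := by gcongr
  have hlow_up : ∀ s, lowerMinkowskiContent A s ≤ upperMinkowskiContent A s := fun s =>
    liminf_le_limsup
  have hset : ∀ M : ℝ → ℝ≥0∞, (∀ s, d < s → M s = 0) → (∀ s, s ≤ d → 0 < M s) →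
      sInf {s : ℝ | 0 < s ∧ M s = 0} = d := by
    intro M h1 h2
    have : {s : ℝ | 0 < s ∧ M s = 0} = Ioi d := by
      ext s
      constructor
      · rintro ⟨-, h⟩
        exact lt_of_not_ge fun hs => (h2 s hs).ne' h
      · exact fun hs => ⟨hd.trans hs, h1 s hs⟩
    rw [this, csInf_Ioi]
  exact ⟨hA, hset _ (fun s hs => (hzero s hs).liminf_eq) hpos,
    hset _ (fun s hs => (hzero s hs).limsup_eq) fun s hs => (hpos s hs).trans_le (hlow_up s)⟩

theorem thickening_neg (A : Set ℝ) (ε : ℝ) : Metric.thickening ε (-A) = -Metric.thickening ε A := by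
  ext x
  simp only [Metric.mem_thickening_iff, Set.mem_neg]
  constructor
  · rintro ⟨z, hz, h⟩
    exact ⟨-z, hz, by rwa [dist_neg_neg]⟩
  · rintro ⟨z, hz, h⟩
    exact ⟨-z, by rwa [neg_neg], by rwa [← dist_neg_neg, neg_neg]⟩

theorem HasBoxDim.neg {A : Set ℝ} {d : ℝ} (h : HasBoxDim A d) : HasBoxDim (-A) d := by
  have hq : minkowskiQuotient (-A) = minkowskiQuotient A := by
    ext s ε
    rw [minkowskiQuotient, minkowskiQuotient, thickening_neg, Measure.measure_neg]
  obtain ⟨h1, h2, h3⟩ := h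
  refine ⟨h1.neg, ?_, ?_⟩
  · rw [← h2, lowerBoxDim, lowerBoxDim]
    simp only [lowerMinkowskiContent, hq]
  · rw [← h3, upperBoxDim, upperBoxDim]
    simp only [upperMinkowskiContent, hq]

/-! ### Slowly converging sequences -/

/-- The quantity `u ^ (-p)` grows by at least `c` per step: with `v = c u ^ p`, its growth factor is
at least `(1 - v)⁻¹ ^ p ≥ (1 + v) ^ p ≥ 1 + v`, and `u ^ (-p) * v = c`. -/
theorem mul_natCast_le_inv_pow {u : ℕ → ℝ} {c : ℝ} {p : ℕ} (hp : 0 < p) (hc : 0 < c)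
    (hu : ∀ j, 0 < u j) (hstep : ∀ j, u (j + 1) ≤ u j - c * u j ^ (p + 1)) (j : ℕ) :
    c * j ≤ ((u j)⁻¹) ^ p := by
  induction j with
  | zero => simpa using pow_nonneg (hu 0).le p
  | succ j ih =>
    have h0 := hu j
    set v := c * u j ^ p with hv
    have hvp : 0 < v := by positivity
    have h1 : u (j + 1) ≤ u j * (1 - v) := (hstep j).trans_eq (by rw [hv]; ring)
    have h2 : 0 < 1 - v := pos_of_mul_pos_right ((hu _).trans_le h1) h0.le
    have h3 : (u j)⁻¹ * (1 + v) ≤ (u (j + 1))⁻¹ := by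
      rw [le_inv_comm₀ (by positivity) (hu _)]
      refine h1.trans ?_
      rw [mul_inv, inv_inv]
      refine mul_le_mul_of_nonneg_left ?_ h0.le
      rw [← one_div, le_div_iff₀ (by positivity)]
      nlinarith
    have h4 : 1 + v ≤ (1 + v) ^ p := le_self_pow₀ (by linarith) hp.ne'
    calc c * ((j + 1 : ℕ) : ℝ) = c * j + c := by push_cast; ring
      _ ≤ ((u j)⁻¹) ^ p + ((u j)⁻¹) ^ p * v := by
          have : ((u j)⁻¹) ^ p * v = c := by
            rw [hv, inv_pow]
            field_simp
          linarith
      _ = ((u j)⁻¹) ^ p * (1 + v) := by ring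
      _ ≤ ((u j)⁻¹) ^ p * (1 + v) ^ p := by gcongr
      _ = ((u j)⁻¹ * (1 + v)) ^ p := (mul_pow _ _ _).symm
      _ ≤ _ := by gcongr

theorem exists_le_of_step {u : ℕ → ℝ} {c : ℝ} {p : ℕ} (hp : 0 < p) (hc : 0 < c)
    (hu : ∀ j, 0 < u j) (hstep : ∀ j, u (j + 1) ≤ u j - c * u j ^ (p + 1)) {τ : ℝ} (hτ : 0 < τ) :
    ∃ j, u j ≤ τ := by
  obtain ⟨j, hj⟩ := exists_nat_gt ((τ⁻¹) ^ p / c)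
  refine ⟨j, ?_⟩
  by_contra! hlt
  have h1 := mul_natCast_le_inv_pow hp hc hu hstep j
  have h2 : ((u j)⁻¹) ^ p ≤ (τ⁻¹) ^ p := by
    have := inv_anti₀ hτ hlt.le
    have := (inv_pos.2 (hu j)).le
    gcongr
  rw [div_lt_iff₀ hc] at hj
  linarith

/-- With `ε = η ^ (p + 1)`, cut the sequence at `n ≈ η ^ (-p) / c`. Later terms lie in `(0, η]`; the
first `n` cost `2 ε` each, about `(2 / c) η` in all. Rounding `n` up and fattening the tail cost at
most `4 ε ≤ 4 η`. -/
theorem volume_thickening_range_le {u : ℕ → ℝ} {c : ℝ} {p : ℕ} (hp : 0 < p) (hc : 0 < c)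
    (hu : ∀ j, 0 < u j) (hstep : ∀ j, u (j + 1) ≤ u j - c * u j ^ (p + 1)) {η : ℝ} (hη : 0 < η)
    (hη1 : η ≤ 1) :
    volume (Metric.thickening (η ^ (p + 1)) (range u)) ≤ ENNReal.ofReal ((2 / c + 5) * η) := by
  set ε := η ^ (p + 1) with hε
  have hεη : ε ≤ η := pow_le_of_le_one hη.le hη1 (by omega)
  have hε0 : 0 < ε := by positivity
  set n := ⌈(η⁻¹) ^ p / c⌉₊ with hn
  have hsub : Metric.thickening ε (range u) ⊆
      (⋃ j ∈ Finset.range n, Metric.ball (u j) ε) ∪ Ioo (-ε) (η + ε) := by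
    intro x hx
    obtain ⟨_, ⟨j, rfl⟩, hj⟩ := Metric.mem_thickening_iff.1 hx
    by_cases hjn : j < n
    · exact Or.inl (mem_biUnion (Finset.mem_coe.2 (Finset.mem_range.2 hjn)) hj)
    · right
      have h1 : (η⁻¹) ^ p / c ≤ j := (Nat.le_ceil _).trans (by exact_mod_cast not_lt.1 hjn)
      rw [div_le_iff₀ hc] at h1
      have h2 : η⁻¹ ≤ (u j)⁻¹ := le_of_pow_le_pow_left₀ hp.ne' (inv_pos.2 (hu j)).le
        (h1.trans ((mul_comm _ _).trans_le (mul_natCast_le_inv_pow hp hc hu hstep j)))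
      have h3 : u j ≤ η := (inv_le_inv₀ hη (hu j)).1 h2
      rw [Real.dist_eq, abs_lt] at hj
      have := hu j
      exact ⟨by linarith, by linarith⟩
  have hncast : (n : ℝ) ≤ (η⁻¹) ^ p / c + 1 := (Nat.ceil_lt_add_one (by positivity)).le
  calc volume (Metric.thickening ε (range u))
      ≤ volume (⋃ j ∈ Finset.range n, Metric.ball (u j) ε) + volume (Ioo (-ε) (η + ε)) :=
        (measure_mono hsub).trans (measure_union_le _ _)
    _ ≤ ∑ j ∈ Finset.range n, volume (Metric.ball (u j) ε) + volume (Ioo (-ε) (η + ε)) := by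
        gcongr
        exact measure_biUnion_finset_le _ _
    _ = ENNReal.ofReal (n * (2 * ε) + (η + 2 * ε)) := by
        rw [ENNReal.ofReal_add (by positivity) (by positivity), ENNReal.ofReal_mul (by positivity)]
        simp only [Real.volume_ball, Real.volume_Ioo, Finset.sum_const, Finset.card_range,
          nsmul_eq_mul, ENNReal.ofReal_natCast]
        ring_nf
    _ ≤ _ := by
        refine ENNReal.ofReal_le_ofReal ?_
        have h1 : (n : ℝ) * (2 * ε) ≤ ((η⁻¹) ^ p / c + 1) * (2 * ε) := by gcongr
        have h2 : ((η⁻¹) ^ p / c + 1) * (2 * ε) = 2 / c * η + 2 * ε := by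
          rw [hε, inv_pow]
          field_simp
          ring
        nlinarith

/-- Once the terms are at most `κ η`, gaps are at most `D (κ η) ^ m < η ^ m`, so the neighbourhoods
of the tail merge and cover an interval starting at `0`. By `hhalf` the first term of that tail is
still above `κ η / 2`. -/
theorem le_volume_thickening_range {u : ℕ → ℝ} {D κ : ℝ} {m : ℕ} (hu : ∀ j, 0 < u j)
    (hanti : Antitone u) (hhalf : ∀ j, u j / 2 ≤ u (j + 1)) (hD : 0 ≤ D)
    (hgap : ∀ j, u j - u (j + 1) ≤ D * u j ^ m) (hsmall : ∀ τ > 0, ∃ j, u j ≤ τ)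
    (hκ : 0 < κ) (hκD : D * κ ^ m < 1) {η : ℝ} (hη : 0 < η) (hη0 : κ * η < u 0) :
    ENNReal.ofReal (κ / 2 * η) ≤ volume (Metric.thickening (η ^ m) (range u)) := by
  classical
  have first : ∀ τ > 0, τ < u 0 → ∃ k, u (k + 1) ≤ τ ∧ τ < u k := by
    intro τ hτ hτ0
    have hex := hsmall τ hτ
    obtain ⟨k, hk⟩ : ∃ k, Nat.find hex = k + 1 := Nat.exists_eq_succ_of_ne_zero fun h0 => by
      have := Nat.find_spec hex
      rw [h0] at this
      linarith
    refine ⟨k, hk ▸ Nat.find_spec hex, not_le.1 (Nat.find_min hex (by omega))⟩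
  obtain ⟨k, hk1, hk2⟩ := first (κ * η) (by positivity) hη0
  have hsub : Ioo 0 (u (k + 1)) ⊆ Metric.thickening (η ^ m) (range u) := by
    rintro t ⟨ht0, ht⟩
    obtain ⟨j, hj1, hj2⟩ := first t ht0 (ht.trans_le (hanti (Nat.zero_le _)))
    have hkj : k + 1 ≤ j + 1 := by
      by_contra! hlt
      exact absurd (hanti hlt.le) (by linarith)
    -- The case `j = k` is excluded because `t < u (k + 1)`, so the gap containing `t` starts at a
    -- term not exceeding `κ * η`.
    have hne : k + 1 ≤ j := by
      by_contra! hlt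
      have : k = j := by omega
      subst this
      linarith
    rw [Metric.mem_thickening_iff]
    refine ⟨u (j + 1), mem_range_self _, ?_⟩
    rw [Real.dist_eq, abs_of_nonneg (by linarith)]
    have huj : u j ≤ κ * η := (hanti hne).trans hk1
    have h0 := (hu j).le
    calc t - u (j + 1) < u j - u (j + 1) := by linarith
      _ ≤ D * u j ^ m := hgap j
      _ ≤ D * (κ * η) ^ m := by gcongr
      _ = D * κ ^ m * η ^ m := by ring
      _ ≤ 1 * η ^ m := by gcongr
      _ = η ^ m := one_mul _
  refine le_trans ?_ (measure_mono hsub)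
  rw [Real.volume_Ioo]
  refine ENNReal.ofReal_le_ofReal ?_
  have := hhalf k
  linarith

theorem hasBoxDim_range {u : ℕ → ℝ} {c D : ℝ} {p : ℕ} (hp : 0 < p) (hc : 0 < c) (hD : 0 < D)
    (hu : ∀ j, 0 < u j) (hstep : ∀ j, u (j + 1) ≤ u j - c * u j ^ (p + 1))
    (hgap : ∀ j, u j - u (j + 1) ≤ D * u j ^ (p + 1)) (hhalf : ∀ j, u j / 2 ≤ u (j + 1)) :
    HasBoxDim (range u) (1 - 1 / ((p + 1 : ℕ) : ℝ)) := by
  have hanti : Antitone u := antitone_nat_of_succ_le fun j => by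
    have := hstep j
    have : 0 < c * u j ^ (p + 1) := mul_pos hc (pow_pos (hu j) _)
    linarith
  have hm0 : p + 1 ≠ 0 := by omega
  obtain ⟨κ, hκ, hκD⟩ : ∃ κ > 0, D * κ ^ (p + 1) < 1 := by
    have h1 : Tendsto (fun κ : ℝ => D * κ ^ (p + 1)) (𝓝[>] 0) (𝓝 0) :=
      (Continuous.tendsto' (by fun_prop) _ _ (by simp)).mono_left nhdsWithin_le_nhds
    obtain ⟨κ, h2, h3⟩ := ((h1.eventually_lt_const one_pos).and self_mem_nhdsWithin).exists
    exact ⟨κ, h3, h2⟩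
  have hroot : ∀ ε : ℝ, 0 < ε → (ε ^ (1 / ((p + 1 : ℕ) : ℝ))) ^ (p + 1) = ε := fun ε hε => by
    rw [one_div]
    exact Real.rpow_inv_natCast_pow hε.le hm0
  have hrt : Tendsto (fun ε : ℝ => ε ^ (1 / ((p + 1 : ℕ) : ℝ))) (𝓝[>] 0) (𝓝 0) := by
    have h1 : 0 < 1 / ((p + 1 : ℕ) : ℝ) := by positivity
    have := (Real.continuousAt_rpow_const 0 (1 / ((p + 1 : ℕ) : ℝ)) (Or.inr h1.le)).tendsto
    rw [Real.zero_rpow h1.ne'] at this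
    exact this.mono_left nhdsWithin_le_nhds
  refine hasBoxDim_of_volume_thickening (c := κ / 2) (C := 2 / c + 5) ?_ ?_ (by positivity) ?_ ?_
  · refine (Metric.isBounded_Icc 0 (u 0)).subset ?_
    rintro _ ⟨j, rfl⟩
    exact ⟨(hu j).le, hanti (Nat.zero_le j)⟩
  · have : (1 : ℝ) < ((p + 1 : ℕ) : ℝ) := by exact_mod_cast (by omega : 1 < p + 1)
    rw [sub_pos, div_lt_one (by linarith)]
    exact this
  · filter_upwards [self_mem_nhdsWithin, hrt.eventually_lt_const one_pos] with ε hε h1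
    have := volume_thickening_range_le hp hc hu hstep (Real.rpow_pos_of_pos hε _) h1.le
    rw [hroot ε hε] at this
    rwa [sub_sub_cancel]
  · have hκ0 : Tendsto (fun ε : ℝ => κ * ε ^ (1 / ((p + 1 : ℕ) : ℝ))) (𝓝[>] 0) (𝓝 0) := by
      simpa using hrt.const_mul κ
    filter_upwards [self_mem_nhdsWithin, hκ0.eventually_lt_const (hu 0)] with ε hε h1
    have := le_volume_thickening_range hu hanti hhalf hD.le hgap
      (fun τ hτ => exists_le_of_step hp hc hu hstep hτ) hκ hκD (Real.rpow_pos_of_pos hε _) h1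
    rw [hroot ε hε] at this
    rwa [sub_sub_cancel]

/-! ### Orbits of the characteristic map -/

theorem HasCharForm.eventually_bounds {C : ℝ → ℝ} {a : ℝ} {p : ℕ} (hp : 0 < p) (ha : a < 0)
    (hC : HasCharForm C a (p + 1)) :
    ∀ᶠ x in 𝓝[>] (0 : ℝ), C x ≤ x - -a / 4 * x ^ (p + 1) ∧ x - C x ≤ -a * x ^ (p + 1) ∧
      x / 2 ≤ C x := by
  have h1 := (hC.trans_isLittleO (isLittleO_pow_pow (Nat.lt_succ_self (p + 1)))).mono
    (nhdsWithin_le_nhds (s := Ioi 0))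
  have h2 : Tendsto (fun x : ℝ => -a * x ^ p) (𝓝[>] 0) (𝓝 0) :=
    (Continuous.tendsto' (by fun_prop) _ _ (by simp [hp.ne'])).mono_left nhdsWithin_le_nhds
  -- An error below half of the leading coefficient `-a / 2` keeps each step between `-a / 4` and
  -- `-3 a / 4` times `x ^ (p + 1)`.
  filter_upwards [isLittleO_iff.1 h1 (show 0 < -a / 4 by linarith), self_mem_nhdsWithin,
    h2.eventually_lt_const (half_pos one_pos)] with x hx (hx0 : 0 < x) hxp
  have hpow : 0 < x ^ (p + 1) := by positivity
  rw [Real.norm_eq_abs, Real.norm_eq_abs, abs_of_pos hpow, abs_le] at hx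
  have hap : 0 < -a * x ^ (p + 1) := mul_pos (by linarith) hpow
  have h3 : -a * x ^ (p + 1) ≤ x / 2 := by
    rw [pow_succ]
    nlinarith
  exact ⟨by linarith, by linarith, by linarith⟩

theorem HasCharForm.hasBoxDim_forwardOrbit_of_pos {C : ℝ → ℝ} {a : ℝ} {p : ℕ} (hp : 0 < p)
    (ha : a < 0) (hC : HasCharForm C a (p + 1)) :
    ∀ᶠ x in 𝓝[>] (0 : ℝ), HasBoxDim (forwardOrbit C x) (1 - 1 / ((p + 1 : ℕ) : ℝ)) := by
  obtain ⟨r, hr, hb⟩ := mem_nhdsGT_iff_exists_Ioo_subset.1 (hC.eventually_bounds hp ha)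
  filter_upwards [Ioo_mem_nhdsGT hr] with x hx
  have hmem : ∀ j, C^[j] x ∈ Ioo 0 r := by
    intro j
    induction j with
    | zero => exact hx
    | succ j ih =>
      rw [Function.iterate_succ_apply']
      obtain ⟨h1, h2, h3⟩ := hb ih
      have : 0 < -a / 4 * (C^[j] x) ^ (p + 1) :=
        mul_pos (by linarith) (pow_pos ih.1 _)
      exact ⟨by linarith [ih.1], by linarith [ih.2]⟩
  refine hasBoxDim_range hp (c := -a / 4) (D := -a) (by linarith) (by linarith)
    (fun j => (hmem j).1) (fun j => ?_) (fun j => ?_) fun j => ?_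
  all_goals
    simp only [Function.iterate_succ_apply']
  · exact (hb (hmem j)).1
  · exact (hb (hmem j)).2.1
  · exact (hb (hmem j)).2.2

/-- Oddness of `m` preserves the coefficient `a` under reflection, so orbits on the left of `0`
reduce to orbits on the right. -/
theorem HasCharForm.conj_neg {C : ℝ → ℝ} {a : ℝ} {m : ℕ} (hm : Odd m) (hC : HasCharForm C a m) :
    HasCharForm (fun x => -C (-x)) a m := by
  have hneg : Tendsto (fun x : ℝ => -x) (𝓝 0) (𝓝 0) := Continuous.tendsto' (by fun_prop) _ _ (by simp)
  refine ((hC.comp_tendsto hneg).neg_left.trans (isBigO_of_le _ fun x => ?_)).congr_left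
    fun x => ?_
  · simp
  · simp only [Function.comp_apply, hm.neg_pow]
    ring

theorem forwardOrbit_conj_neg (C : ℝ → ℝ) (x : ℝ) :
    forwardOrbit C x = -forwardOrbit (fun x => -C (-x)) (-x) := by
  have h : ∀ j, (fun x => -C (-x))^[j] (-x) = -(C^[j] x) := by
    intro j
    induction j with
    | zero => rfl
    | succ j ih => simp only [Function.iterate_succ_apply', ih, neg_neg]
  ext z
  simp only [forwardOrbit, Set.mem_neg, mem_range, h, neg_inj]

/-- A characteristic map with the leading term `a x ^ m / 2`, `a < 0`, `m` odd, has
characteristic box dimension `1 - 1 / m`. -/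
theorem HasCharForm.hasCharBoxDim {C : ℝ → ℝ} {a : ℝ} {m : ℕ} (hm : Odd m) (hm1 : 1 < m)
    (ha : a < 0) (hC : HasCharForm C a m) : HasCharBoxDim C (1 - 1 / (m : ℝ)) := by
  obtain ⟨p, rfl⟩ : ∃ p, m = p + 1 := ⟨m - 1, by omega⟩
  have hp : 0 < p := by omega
  rw [HasCharBoxDim, ← Iio_union_Ioi, nhdsWithin_union, eventually_sup]
  refine ⟨?_, hC.hasBoxDim_forwardOrbit_of_pos hp ha⟩
  have hneg : Tendsto (fun x : ℝ => -x) (𝓝[<] 0) (𝓝[>] 0) := by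
    simpa using tendsto_neg_nhdsLT (a := (0 : ℝ))
  filter_upwards [hneg.eventually ((hC.conj_neg hm).hasBoxDim_forwardOrbit_of_pos hp ha)] with x hx
  rw [forwardOrbit_conj_neg]
  exact hx.neg

theorem HasCharBoxDim.unique {C : ℝ → ℝ} {d d' : ℝ} (h : HasCharBoxDim C d)
    (h' : HasCharBoxDim C d') : d = d' := by
  obtain ⟨x, hx, hx'⟩ := (h.and h').exists
  exact hx.2.1.symm.trans hx'.2.1

/-! ### The linear part -/

/-- The nilpotent linear map `(x, y) ↦ (y, 0)`. -/
noncomputable def nilpotentPart : ℝ × ℝ →L[ℝ] ℝ × ℝ :=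
  (ContinuousLinearMap.snd ℝ ℝ ℝ).prod 0

section LeadingTerms

variable {f g : ℝ → ℝ} {H : ℝ × ℝ → ℝ} {a b : ℝ} {m n : ℕ}

theorem isBigO_pow_of_leading
    (hf : (fun x => f x - a * x ^ m) =O[𝓝 0] fun x : ℝ => x ^ (m + 1)) :
    f =O[𝓝 0] fun x : ℝ => x ^ m := by
  have h1 : (fun x : ℝ => x ^ (m + 1)) =O[𝓝 0] fun x : ℝ => x ^ m :=
    (isLittleO_pow_pow (Nat.lt_succ_self m)).isBigO
  simpa using (hf.trans h1).add ((isBigO_refl (fun x : ℝ => x ^ m) (𝓝 0)).const_mul_left a)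

theorem eq_zero_of_isBigO_pow (hm : 0 < m) (hf : f =O[𝓝 0] fun x : ℝ => x ^ m) : f 0 = 0 := by
  obtain ⟨c, hc⟩ := hf.bound
  simpa [hm.ne'] using hc.self_of_nhds

theorem contDiffAt_nodeField (hfs : SmoothNear f 0) (hgs : SmoothNear g 0)
    (hHs : SmoothNear H 0) : ContDiffAt ℝ ∞ (nodeField f g H) 0 := by
  have hx : ContDiffAt ℝ ∞ (Prod.fst : ℝ × ℝ → ℝ) 0 := contDiffAt_fst
  have hy : ContDiffAt ℝ ∞ (Prod.snd : ℝ × ℝ → ℝ) 0 := contDiffAt_snd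
  exact hy.prodMk (((hfs.contDiffAt.comp (0 : ℝ × ℝ) hx).add
    (hy.mul (hgs.contDiffAt.comp (0 : ℝ × ℝ) hx))).add ((hy.pow 2).mul hHs.contDiffAt))

theorem hasFDerivAt_nodeField (hgs : SmoothNear g 0) (hHs : SmoothNear H 0)
    (hm : 1 < m) (hf : f =O[𝓝 0] fun x : ℝ => x ^ m) (hg : g 0 = 0) :
    HasFDerivAt (nodeField f g H) nilpotentPart 0 := by
  have hf0 : HasFDerivAt f (0 : ℝ →L[ℝ] ℝ) 0 := by
    rw [hasFDerivAt_iff_isLittleO_nhds_zero]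
    simpa [eq_zero_of_isBigO_pow (by omega) hf] using hf.trans_isLittleO (isLittleO_pow_id hm)
  have hx : HasFDerivAt (Prod.fst : ℝ × ℝ → ℝ) (ContinuousLinearMap.fst ℝ ℝ ℝ) 0 := hasFDerivAt_fst
  have h1 : HasFDerivAt (fun p : ℝ × ℝ => f p.1) (0 : ℝ × ℝ →L[ℝ] ℝ) 0 := by
    simpa [Function.comp_def] using HasFDerivAt.comp (g := f) (0 : ℝ × ℝ) hf0 hx
  have h2 := HasFDerivAt.comp (g := g) (0 : ℝ × ℝ)
    (hgs.contDiffAt.differentiableAt (by simp)).hasFDerivAt hx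
  have h3 := (hHs.contDiffAt.differentiableAt (by simp)).hasFDerivAt
  have hy : HasFDerivAt (Prod.snd : ℝ × ℝ → ℝ) (ContinuousLinearMap.snd ℝ ℝ ℝ) 0 := hasFDerivAt_snd
  have h4 := hy.prodMk ((h1.add (hy.mul h2)).add ((hy.pow 2).mul h3))
  refine h4.congr_fderiv ?_
  ext <;> simp [nilpotentPart, hg]

theorem isNilpotentSingularity_nodeField (hgs : SmoothNear g 0) (hHs : SmoothNear H 0)
    (hm : 1 < m) (hf : f =O[𝓝 0] fun x : ℝ => x ^ m) (hg : g 0 = 0) :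
    IsNilpotentSingularity (nodeField f g H) := by
  rw [IsNilpotentSingularity, (hasFDerivAt_nodeField hgs hHs hm hf hg).fderiv]
  refine ⟨?_, fun h => ?_, 2, ?_⟩
  · simp [nodeField, eq_zero_of_isBigO_pow (by omega) hf]
  · simpa [nilpotentPart] using DFunLike.congr_fun h (0, 1)
  · rw [pow_two]
    ext <;> simp [nilpotentPart]

end LeadingTerms

/-! ### Existence of the unit-time map -/

/-- The time-one flow of a vector field with a singularity of small linear part. -/
theorem exists_unit_time_solution {E : Type*} [NormedAddCommGroup E] [NormedSpace ℝ E]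
    [CompleteSpace E] {V : E → E} {L : E →L[ℝ] E} (hV : HasStrictFDerivAt V L 0) (hV0 : V 0 = 0)
    (hL : ‖L‖₊ < 1 / 2) :
    ∀ᶠ p in 𝓝 (0 : E), ∃ γ : ℝ → E, γ 0 = p ∧
      ∀ t ∈ Icc (0 : ℝ) 1, HasDerivWithinAt γ (V (γ t)) (Icc 0 1) t := by
  obtain ⟨s, hs, hlip⟩ := hV.exists_lipschitzOnWith_of_nnnorm_lt (1 / 2) hL
  obtain ⟨r, hr, hrs⟩ := Metric.nhds_basis_closedBall.mem_iff.1 hs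
  lift r to NNReal using hr.le
  -- On the ball of radius `r` the speed is at most `r / 2`, so a solution starting within `r / 2`
  -- stays in the ball for time `1`.
  have hPL : IsPicardLindelof (fun _ : ℝ => V) (tmin := 0) (tmax := 1)
      ⟨0, left_mem_Icc.2 zero_le_one⟩ (0 : E) r (r / 2) (r / 2) (1 / 2) := by
    refine ⟨fun _ _ => hlip.mono hrs, fun _ _ => continuousOn_const, fun _ _ x hx => ?_, ?_⟩
    · have h1 := hlip.norm_sub_le (hrs hx) (mem_of_mem_nhds hs)
      rw [hV0, sub_zero, sub_zero] at h1
      have h2 : ‖x‖ ≤ r := by simpa using hx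
      push_cast at h1 ⊢
      linarith
    · push_cast
      simp
      linarith
  have hr2 : (0 : ℝ) < (r / 2 : NNReal) := by
    push_cast
    linarith
  filter_upwards [Metric.closedBall_mem_nhds (0 : E) hr2] with p hp
  exact hPL.exists_eq_forall_mem_Icc_hasDerivWithinAt hp

/-- The rescaling `(x, z) ↦ (x, z / 4)`. -/
noncomputable def rescale : (ℝ × ℝ) ≃L[ℝ] ℝ × ℝ :=
  (ContinuousLinearEquiv.refl ℝ ℝ).prodCongr
    (ContinuousLinearEquiv.unitsEquivAut ℝ (Units.mk0 (1 / 4 : ℝ) (by norm_num)))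

/-- The linear part itself is too large for `exists_unit_time_solution`. Being nilpotent, it can be
made small by a linear change of coordinates: `rescale` turns it into `(x, z) ↦ (z / 4, 0)`. -/
theorem exists_isUnitTimeMap {V : ℝ × ℝ → ℝ × ℝ} (hV : HasStrictFDerivAt V nilpotentPart 0)
    (hV0 : V 0 = 0) : ∃ U : ℝ × ℝ → ℝ × ℝ, IsUnitTimeMap V U := by
  let V' : ℝ × ℝ → ℝ × ℝ := fun p => rescale.symm (V (rescale p))
  let L : ℝ × ℝ →L[ℝ] ℝ × ℝ :=
    (rescale.symm : ℝ × ℝ →L[ℝ] ℝ × ℝ) ∘L nilpotentPart ∘L (rescale : ℝ × ℝ →L[ℝ] ℝ × ℝ)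
  have hV' : HasStrictFDerivAt V' L 0 := by
    have h0 : rescale (0 : ℝ × ℝ) = 0 := map_zero _
    rw [← h0] at hV
    exact rescale.symm.hasStrictFDerivAt.comp 0 (hV.comp 0 rescale.hasStrictFDerivAt)
  have hL : ‖L‖₊ < 1 / 2 := by
    rw [← NNReal.coe_lt_coe, coe_nnnorm]
    refine lt_of_le_of_lt (L.opNorm_le_bound (M := 1 / 4) (by norm_num) fun p => ?_) (by norm_num)
    have : L p = (p.2 * (1 / 4), 0) := by
      simp [L, rescale, nilpotentPart]
    rw [this, Prod.norm_def, norm_zero, max_eq_left (norm_nonneg _), norm_mul, mul_comm]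
    have := norm_snd_le p
    norm_num
    simpa using this
  have hex := exists_unit_time_solution hV' (by simp [V', hV0]) hL
  have hcont : Tendsto (rescale.symm : ℝ × ℝ → ℝ × ℝ) (𝓝 0) (𝓝 0) :=
    rescale.symm.continuous.tendsto' _ _ (map_zero _)
  have hsol : ∀ᶠ p in 𝓝 (0 : ℝ × ℝ), ∃ γ : ℝ → ℝ × ℝ, γ 0 = p ∧
      ∀ t ∈ Icc (0 : ℝ) 1, HasDerivWithinAt γ (V (γ t)) (Icc 0 1) t := by
    filter_upwards [hcont.eventually hex] with p ⟨γ, h0, hγ⟩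
    refine ⟨fun t => rescale (γ t), by simp [h0], fun t ht => ?_⟩
    have := rescale.hasFDerivAt.comp_hasDerivWithinAt t (hγ t ht)
    simpa [V', Function.comp_def] using this
  choose! Γ hΓ using fun p (h : ∃ γ : ℝ → ℝ × ℝ, γ 0 = p ∧
    ∀ t ∈ Icc (0 : ℝ) 1, HasDerivWithinAt γ (V (γ t)) (Icc 0 1) t) => h
  exact ⟨fun p => Γ p 1, hsol.mono fun p hp => ⟨Γ p, (hΓ p hp).1, (hΓ p hp).2, rfl⟩⟩

/-! ### Asymptotics of the characteristic map -/

/-- With weights `x ~ s` and `y ~ s ^ m`, the term `y g` is `O (s ^ (m + 1))` and `y ^ 2 H` is `O (s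
^ (2 m))`, where `2 m ≥ m + 1`; only `a x ^ m` remains. -/
theorem exists_abs_nodeField_snd_sub_le {f g : ℝ → ℝ} {H : ℝ × ℝ → ℝ} {a : ℝ} {m : ℕ} (hm : 1 < m)
    (hf : (fun x => f x - a * x ^ m) =O[𝓝 0] fun x : ℝ => x ^ (m + 1))
    (hg : g =O[𝓝 0] fun x : ℝ => x) (hH : ContinuousAt H 0) {Y : ℝ} (hY : 0 < Y) :
    ∃ K > 0, ∀ᶠ s in 𝓝[>] (0 : ℝ), ∀ p : ℝ × ℝ, |p.1| ≤ 2 * s → |p.2| ≤ Y * s ^ m →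
      |(nodeField f g H p).2 - a * p.1 ^ m| ≤ K * s ^ (m + 1) := by
  obtain ⟨A, hA, hfA⟩ := hf.exists_pos
  obtain ⟨B, hB, hgB⟩ := hg.exists_pos
  have hHM : ∀ᶠ p in 𝓝 (0 : ℝ × ℝ), |H p| < |H 0| + 1 :=
    hH.abs.eventually_lt_const (by linarith)
  have hfst : Tendsto (Prod.fst : ℝ × ℝ → ℝ) (𝓝 0) (𝓝 0) := continuous_fst.tendsto' _ _ rfl
  obtain ⟨r, hr, hb⟩ := Metric.eventually_nhds_iff_ball.1
    ((hfst.eventually hfA.bound).and ((hfst.eventually hgB.bound).and hHM))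
  refine ⟨A * 2 ^ (m + 1) + 2 * Y * B + Y ^ 2 * (|H 0| + 1), by positivity, ?_⟩
  have h1 : Tendsto (fun s : ℝ => 2 * s) (𝓝[>] 0) (𝓝 0) :=
    (Continuous.tendsto' (by fun_prop) _ _ (by simp)).mono_left nhdsWithin_le_nhds
  have h2 : Tendsto (fun s : ℝ => Y * s ^ m) (𝓝[>] 0) (𝓝 0) :=
    (Continuous.tendsto' (by fun_prop) _ _ (by simp [show m ≠ 0 by omega])).mono_left
      nhdsWithin_le_nhds
  filter_upwards [h1.eventually_lt_const hr, h2.eventually_lt_const hr, Ioo_mem_nhdsGT one_pos]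
    with s hs1 hs2 ⟨hs0, hs⟩ p hp1 hp2
  obtain ⟨hb1, hb2, hb3⟩ := hb p (by
    rw [mem_ball_zero_iff, Prod.norm_def, max_lt_iff]
    exact ⟨hp1.trans_lt hs1, hp2.trans_lt hs2⟩)
  rw [norm_pow, Real.norm_eq_abs, Real.norm_eq_abs] at hb1
  rw [Real.norm_eq_abs, Real.norm_eq_abs] at hb2
  have e1 : |f p.1 - a * p.1 ^ m| ≤ A * 2 ^ (m + 1) * s ^ (m + 1) := by
    refine hb1.trans ?_
    rw [mul_assoc, ← mul_pow]
    gcongr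
  have e2 : |p.2 * g p.1| ≤ 2 * Y * B * s ^ (m + 1) := by
    rw [abs_mul]
    calc |p.2| * |g p.1| ≤ (Y * s ^ m) * (B * (2 * s)) := by
          gcongr
          exact hb2.trans (by gcongr)
      _ = _ := by ring
  have e3 : |p.2 ^ 2 * H p| ≤ Y ^ 2 * (|H 0| + 1) * s ^ (m + 1) := by
    rw [abs_mul, abs_pow]
    calc |p.2| ^ 2 * |H p| ≤ (Y * s ^ m) ^ 2 * (|H 0| + 1) := by gcongr
      _ = Y ^ 2 * (|H 0| + 1) * s ^ (m * 2) := by rw [mul_pow, ← pow_mul]; ring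
      _ ≤ _ := by
          have := pow_le_pow_of_le_one hs0.le hs.le (show m + 1 ≤ m * 2 by omega)
          gcongr
  have : (nodeField f g H p).2 - a * p.1 ^ m =
      (f p.1 - a * p.1 ^ m) + p.2 * g p.1 + p.2 ^ 2 * H p := by
    simp only [nodeField]
    ring
  rw [this]
  refine (abs_add_three _ _ _).trans ?_
  linarith

/-- The displacement in time `1` along solutions that start on the axis `y = 0`. -/
theorem exists_abs_solution_sub_le {V : ℝ × ℝ → ℝ × ℝ} {a : ℝ} {m : ℕ} (hm : 1 < m)
    (hV1 : ∀ p, (V p).1 = p.2)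
    (hV2 : ∀ Y > 0, ∃ K > 0, ∀ᶠ s in 𝓝[>] (0 : ℝ), ∀ p : ℝ × ℝ, |p.1| ≤ 2 * s →
      |p.2| ≤ Y * s ^ m → |(V p).2 - a * p.1 ^ m| ≤ K * s ^ (m + 1)) :
    ∃ K : ℝ, ∀ᶠ s in 𝓝[>] (0 : ℝ), ∀ (γ : ℝ → ℝ × ℝ) (x : ℝ), |x| ≤ s → γ 0 = (x, 0) →
      (∀ t ∈ Icc (0 : ℝ) 1, HasDerivWithinAt γ (V (γ t)) (Icc 0 1) t) →
      |(γ 1).1 - (x + a / 2 * x ^ m)| ≤ K * s ^ (m + 1) := by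
  -- For `|x| ≤ 2 s` the leading acceleration is at most `|a| 2 ^ m s ^ m`; the extra `1` absorbs
  -- the error, since `K s < 1`.
  set Y : ℝ := |a| * 2 ^ m + 1 with hY
  have hY0 : 0 < Y := by positivity
  obtain ⟨K, hK, hev⟩ := hV2 Y hY0
  refine ⟨K + |a| * (Y * m * 2 ^ (m - 1)), ?_⟩
  have h1 : Tendsto (fun s : ℝ => K * s) (𝓝[>] 0) (𝓝 0) :=
    (Continuous.tendsto' (by fun_prop) _ _ (by simp)).mono_left nhdsWithin_le_nhds
  have h2 : Tendsto (fun s : ℝ => Y * s) (𝓝[>] 0) (𝓝 0) :=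
    (Continuous.tendsto' (by fun_prop) _ _ (by simp)).mono_left nhdsWithin_le_nhds
  filter_upwards [hev, h1.eventually_lt_const one_pos, h2.eventually_lt_const one_pos,
    Ioo_mem_nhdsGT one_pos] with s hs hKs hYs ⟨hs0, hs1⟩ γ x hx hγ0 hγ
  have hsm : 0 < s ^ m := by positivity
  have hYsm : Y * s ^ m < s := by
    have : s ^ m ≤ s ^ 2 := pow_le_pow_of_le_one hs0.le hs1.le hm
    nlinarith
  have hstrict : ∀ p : ℝ × ℝ, |p.1| ≤ 2 * s → |p.2| ≤ Y * s ^ m → |(V p).2| < Y * s ^ m := by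
    intro p hp1 hp2
    have e1 := hs p hp1 hp2
    have e2 : |a * p.1 ^ m| ≤ |a| * 2 ^ m * s ^ m := by
      rw [abs_mul, abs_pow, mul_assoc, ← mul_pow]
      gcongr
    have e3 : |(V p).2| ≤ |(V p).2 - a * p.1 ^ m| + |a * p.1 ^ m| := by
      simpa using abs_add_le ((V p).2 - a * p.1 ^ m) (a * p.1 ^ m)
    have e4 : K * s ^ (m + 1) < s ^ m := by
      rw [pow_succ]
      nlinarith
    rw [hY]
    linarith
  have hd1 : ∀ t ∈ Icc (0 : ℝ) 1, HasDerivWithinAt (fun t => (γ t).1) (γ t).2 (Icc 0 1) t := by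
    intro t ht
    have := (ContinuousLinearMap.fst ℝ ℝ ℝ).hasFDerivAt.comp_hasDerivWithinAt t (hγ t ht)
    simpa [Function.comp_def, hV1] using this
  have hd2 : ∀ t ∈ Icc (0 : ℝ) 1, HasDerivWithinAt (fun t => (γ t).2) (V (γ t)).2 (Icc 0 1) t := by
    intro t ht
    have := (ContinuousLinearMap.snd ℝ ℝ ℝ).hasFDerivAt.comp_hasDerivWithinAt t (hγ t ht)
    simpa [Function.comp_def] using this
  have hx0 : (γ 0).1 = x := by rw [hγ0]
  have hy0 : (γ 0).2 = 0 := by rw [hγ0]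
  -- Barrier argument: the displacement, scaled by `s` in `x` and `Y s ^ m` in `y`, has sup norm `0`
  -- at time `0` and speed below `1` whenever its norm equals `t`, so its norm never exceeds `t`.
  have hbox : ∀ t ∈ Icc (0 : ℝ) 1, |(γ t).1| ≤ 2 * s ∧ |(γ t).2| ≤ Y * s ^ m := by
    have unpack : ∀ t, t ≤ 1 → ‖(((γ t).1 - x) / s, (γ t).2 / (Y * s ^ m))‖ ≤ t →
        |(γ t).1| ≤ 2 * s ∧ |(γ t).2| ≤ Y * s ^ m := by
      intro t ht hn
      rw [Prod.norm_def, max_le_iff, Real.norm_eq_abs, Real.norm_eq_abs, abs_div, abs_div,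
        abs_of_pos hs0, abs_of_pos (mul_pos hY0 hsm), div_le_iff₀ hs0,
        div_le_iff₀ (mul_pos hY0 hsm)] at hn
      have h3 : |(γ t).1 - x| ≤ s := hn.1.trans (mul_le_of_le_one_left hs0.le ht)
      have h4 : |(γ t).1| ≤ |(γ t).1 - x| + |x| := by simpa using abs_add_le ((γ t).1 - x) x
      exact ⟨by linarith, hn.2.trans (mul_le_of_le_one_left (mul_pos hY0 hsm).le ht)⟩
    have hE : ∀ t ∈ Icc (0 : ℝ) 1, HasDerivWithinAt
        (fun t => (((γ t).1 - x) / s, (γ t).2 / (Y * s ^ m)))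
        ((γ t).2 / s, (V (γ t)).2 / (Y * s ^ m)) (Icc 0 1) t := fun t ht =>
      (((hd1 t ht).sub_const x).div_const s).prodMk ((hd2 t ht).div_const _)
    intro t ht
    refine unpack t ht.2 (image_norm_le_of_norm_deriv_right_lt_deriv_boundary (B := fun t => t)
      (B' := fun _ => 1) (fun t ht => (hE t ht).continuousWithinAt)
      (fun t ht => (hE t (Ico_subset_Icc_self ht)).mono_of_mem_nhdsWithin
        (Icc_mem_nhdsGE_of_mem ht)) (by simp [hx0, hy0]) (fun t => hasDerivAt_id t)
      (fun t ht hn => ?_) ht)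
    obtain ⟨h3, h4⟩ := unpack t ht.2.le hn.le
    rw [Prod.norm_def, max_lt_iff, Real.norm_eq_abs, Real.norm_eq_abs, abs_div, abs_div,
      abs_of_pos hs0, abs_of_pos (mul_pos hY0 hsm), div_lt_one hs0, div_lt_one (mul_pos hY0 hsm)]
    exact ⟨h4.trans_lt hYsm, hstrict _ h3 h4⟩
  have hxdisp : ∀ t ∈ Icc (0 : ℝ) 1, |(γ t).1 - x| ≤ Y * s ^ m := by
    intro t ht
    have := norm_image_sub_le_of_norm_deriv_le_segment' hd1 (C := Y * s ^ m)
      (fun t ht => (hbox t (Ico_subset_Icc_self ht)).2) t ht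
    rw [hx0, Real.norm_eq_abs, sub_zero] at this
    exact this.trans (mul_le_of_le_one_right (mul_pos hY0 hsm).le ht.2)
  set K' := K + |a| * (Y * m * 2 ^ (m - 1)) with hK'
  have hK'0 : 0 ≤ K' * s ^ (m + 1) := by positivity
  have hacc : ∀ t ∈ Icc (0 : ℝ) 1, |(V (γ t)).2 - a * x ^ m| ≤ K' * s ^ (m + 1) := by
    intro t ht
    obtain ⟨h3, h4⟩ := hbox t ht
    have e1 := hs _ h3 h4
    have e2 : |(γ t).1 ^ m - x ^ m| ≤ Y * m * 2 ^ (m - 1) * s ^ (m + 1) := by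
      refine (abs_pow_sub_pow_le _ _ _).trans ?_
      have h5 : max |(γ t).1| |x| ≤ 2 * s := max_le h3 (by linarith)
      calc |(γ t).1 - x| * m * max |(γ t).1| |x| ^ (m - 1)
          ≤ (Y * s ^ m) * m * (2 * s) ^ (m - 1) := by
            have := hxdisp t ht
            gcongr
        _ = Y * m * 2 ^ (m - 1) * (s ^ (m - 1) * s ^ m) := by ring
        _ ≤ Y * m * 2 ^ (m - 1) * s ^ (m + 1) := by
            rw [← pow_add]
            have := pow_le_pow_of_le_one hs0.le hs1.le (show m + 1 ≤ m - 1 + m by omega)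
            gcongr
    have e3 : |(V (γ t)).2 - a * x ^ m| ≤
        |(V (γ t)).2 - a * (γ t).1 ^ m| + |a| * |(γ t).1 ^ m - x ^ m| := by
      rw [← abs_mul]
      refine le_trans (le_of_eq ?_) (abs_add_le _ _)
      ring_nf
    have e4 := mul_le_mul_of_nonneg_left e2 (abs_nonneg a)
    rw [hK']
    linarith
  -- The nearly constant acceleration `a x ^ m` is integrated here and once more below; `t ^ 2 / 2`
  -- at `t = 1` produces the factor `a / 2`.
  have hvel : ∀ t ∈ Icc (0 : ℝ) 1, |(γ t).2 - a * x ^ m * t| ≤ K' * s ^ (m + 1) := by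
    intro t ht
    have := norm_image_sub_le_of_norm_deriv_le_segment' (f := fun t => (γ t).2 - a * x ^ m * t)
      (f' := fun t => (V (γ t)).2 - a * x ^ m) (C := K' * s ^ (m + 1))
      (fun t ht => by
        simpa [Pi.sub_def] using (hd2 t ht).sub ((hasDerivWithinAt_id t (Icc 0 1)).const_mul (a * x ^ m)))
      (fun t ht => hacc t (Ico_subset_Icc_self ht)) t ht
    rw [hy0, mul_zero, sub_zero, sub_zero, sub_zero, Real.norm_eq_abs] at this
    exact this.trans (mul_le_of_le_one_right hK'0 ht.2)
  have := norm_image_sub_le_of_norm_deriv_le_segment_01'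
    (f := fun t => (γ t).1 - a * x ^ m * (t ^ 2 / 2))
    (f' := fun t => (γ t).2 - a * x ^ m * t) (C := K' * s ^ (m + 1))
    (fun t ht => by
      have h3 : HasDerivWithinAt (fun t : ℝ => t ^ 2 / 2) t (Icc 0 1) t := by
        simpa using ((hasDerivAt_pow 2 t).div_const 2).hasDerivWithinAt
      exact (hd1 t ht).sub (h3.const_mul (a * x ^ m)))
    (fun t ht => hvel t (Ico_subset_Icc_self ht))
  rw [Real.norm_eq_abs, hx0] at this
  refine le_trans (le_of_eq ?_) this
  ring_nf

theorem hasCharForm_of_isUnitTimeMap {f g : ℝ → ℝ} {H : ℝ × ℝ → ℝ} {a : ℝ} {m : ℕ} (hm : 1 < m)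
    (hf : (fun x => f x - a * x ^ m) =O[𝓝 0] fun x : ℝ => x ^ (m + 1))
    (hg : g =O[𝓝 0] fun x : ℝ => x) (hH : ContinuousAt H 0) {U : ℝ × ℝ → ℝ × ℝ}
    (hU : IsUnitTimeMap (nodeField f g H) U) : HasCharForm (charMap U fun _ => 0) a m := by
  obtain ⟨K, hK⟩ := exists_abs_solution_sub_le (V := nodeField f g H) hm (fun _ => rfl)
    (fun Y hY => exists_abs_nodeField_snd_sub_le hm hf hg hH hY)
  obtain ⟨r, hr, hb⟩ := mem_nhdsGT_iff_exists_Ioo_subset.1 hK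
  have hslice : Tendsto (fun x : ℝ => (x, (0 : ℝ))) (𝓝 0) (𝓝 0) :=
    Continuous.tendsto' (by fun_prop) _ _ rfl
  refine IsBigO.of_bound K ?_
  filter_upwards [hslice.eventually hU, Metric.ball_mem_nhds (0 : ℝ) hr] with x ⟨γ, h0, hγ, h1⟩ hx
  rw [mem_ball_zero_iff, Real.norm_eq_abs] at hx
  rw [norm_pow, Real.norm_eq_abs, Real.norm_eq_abs, charMap, h1]
  -- The estimate requires `s > 0`; letting `s` decrease to `|x|` covers `x = 0` as well.
  have hlim : Tendsto (fun s : ℝ => K * s ^ (m + 1)) (𝓝[>] |x|) (𝓝 (K * |x| ^ (m + 1))) :=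
    (Continuous.tendsto (by fun_prop) _).mono_left nhdsWithin_le_nhds
  refine ge_of_tendsto hlim ?_
  filter_upwards [Ioo_mem_nhdsGT hx] with s hs
  exact hb ⟨(abs_nonneg x).trans_lt hs.1, hs.2⟩ γ x hs.1.le h0 hγ

end PlanarSystem

/-! ### The equivalences -/

open PlanarSystem in
theorem proposition2 (f g : ℝ → ℝ) (H : ℝ × ℝ → ℝ) (a b : ℝ) (m n : ℕ)
    (hf_smooth : PlanarSystem.SmoothNear f 0)
    (hg_smooth : PlanarSystem.SmoothNear g 0)
    (hH_smooth : PlanarSystem.SmoothNear H 0)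
    (hf : (fun x => f x - a * x ^ m) =O[𝓝 0] fun x : ℝ => x ^ (m + 1))
    (hg : (fun x => g x - b * x ^ n) =O[𝓝 0] fun x : ℝ => x ^ (n + 1))
    (hm : Odd m) (ha : a < 0) (hn : Even n) (hn_pos : 0 < n) (hb : b ≠ 0)
    (hmn : 2 * n + 1 < m ∨ (m = 2 * n + 1 ∧ 0 ≤ b ^ 2 + 4 * a * ((n : ℝ) + 1))) :
    PlanarSystem.IsCharacteristicCurve (PlanarSystem.nodeField f g H) (fun _ => 0) ∧
    (∃ U : ℝ × ℝ → ℝ × ℝ, PlanarSystem.IsUnitTimeMap (PlanarSystem.nodeField f g H) U) ∧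
    ∀ U : ℝ × ℝ → ℝ × ℝ, PlanarSystem.IsUnitTimeMap (PlanarSystem.nodeField f g H) U →
      PlanarSystem.HasCharForm (PlanarSystem.charMap U fun _ => 0) a m ∧
      ∀ k : ℕ, 1 ≤ k →
        (PlanarSystem.HasCharBoxDim (PlanarSystem.charMap U fun _ => 0) (1 - 1 / (k : ℝ)) ↔
          PlanarSystem.IsMultipleNilpotentPoint (PlanarSystem.nodeField f g H) k) ∧
        (PlanarSystem.HasCharForm (PlanarSystem.charMap U fun _ => 0) a k ∧
            PlanarSystem.HasCharBoxDim (PlanarSystem.charMap U fun _ => 0) (1 - 1 / (k : ℝ)) ↔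
          PlanarSystem.IsMultipleNilpotentPoint (PlanarSystem.nodeField f g H) k) ∧
        (PlanarSystem.IsNode (PlanarSystem.nodeField f g H) →
          (PlanarSystem.HasCharForm (PlanarSystem.charMap U fun _ => 0) a k ∧
              PlanarSystem.HasCharBoxDim (PlanarSystem.charMap U fun _ => 0) (1 - 1 / (k : ℝ)) ↔
            PlanarSystem.IsMultipleNilpotentNode (PlanarSystem.nodeField f g H) k)) := by
  have hm1 : 1 < m := by omega
  have hf' := isBigO_pow_of_leading hf
  have hg' := isBigO_pow_of_leading hg
  have hg0 : g 0 = 0 := eq_zero_of_isBigO_pow hn_pos hg'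
  have hglin : g =O[𝓝 0] fun x : ℝ => x := by
    refine hg'.trans (IsBigO.of_bound 1 ?_)
    filter_upwards [Metric.ball_mem_nhds (0 : ℝ) one_pos] with x hx
    rw [mem_ball_zero_iff] at hx
    rw [one_mul, norm_pow]
    exact pow_le_of_le_one (norm_nonneg x) hx.le hn_pos.ne'
  have hstrict : HasStrictFDerivAt (nodeField f g H) nilpotentPart 0 :=
    (contDiffAt_nodeField hf_smooth hg_smooth hH_smooth).hasStrictFDerivAt'
      (hasFDerivAt_nodeField hg_smooth hH_smooth hm1 hf' hg0) (by simp)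
  have hnil := isNilpotentSingularity_nodeField hg_smooth hH_smooth hm1 hf' hg0
  refine ⟨⟨rfl, Eventually.of_forall fun p => Iff.rfl⟩, exists_isUnitTimeMap hstrict hnil.1,
    fun U hU => ?_⟩
  have hform : HasCharForm (charMap U fun _ => 0) a m :=
    hasCharForm_of_isUnitTimeMap hm1 hf hglin hH_smooth.contDiffAt.continuousAt hU
  have hdim := hform.hasCharBoxDim hm hm1 ha
  refine ⟨hform, fun k hk => ?_⟩
  -- Each condition is reduced to `k = m`, from which all the equivalences follow.
  have hmult : IsMultipleNilpotentPoint (nodeField f g H) k ↔ k = m := by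
    rw [IsMultipleNilpotentPoint,
      hasMultiplicity_nodeField_iff ha.ne hf_smooth hg_smooth hH_smooth hf k]
    exact and_iff_right hnil
  have hbox : HasCharBoxDim (charMap U fun _ => 0) (1 - 1 / (k : ℝ)) ↔ k = m := by
    constructor
    · intro h
      have h1 := h.unique hdim
      rw [sub_right_inj, one_div, one_div, inv_inj] at h1
      exact_mod_cast h1
    · rintro rfl
      exact hdim
  have hboth : (HasCharForm (charMap U fun _ => 0) a k ∧
      HasCharBoxDim (charMap U fun _ => 0) (1 - 1 / (k : ℝ))) ↔ k = m := by
    rw [hbox]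
    exact and_iff_right_of_imp fun h => h ▸ hform
  refine ⟨hbox.trans hmult.symm, hboth.trans hmult.symm, fun hnode => ?_⟩
  rw [IsMultipleNilpotentNode, hboth, hmult]
  exact (and_iff_right hnode).symm
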